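/- Let $N\ge 1$ be an odd integer, $\phi\in(0,\pi/4)$ and $\theta\in\mathbb R$. On $(\mathbb C^2)^{\otimes N}$ let $\sigma_j^\gamma$ ($\gamma=x,y,z$; $j=1,\dots,N$; $\sigma^\gamma_{N+1}=\sigma^\gamma_1$) be the Pauli operators, $\Pi^\gamma=\bigotimes_{j=1}^N\sigma_j^\gamma$, and $$H=\sum_{j=1}^N\big(\cos\phi\,\sigma_j^x\sigma_{j+1}^x+\sin\phi\,\sigma_j^y\sigma_{j+1}^y\big).$$ Let $|0\rangle$ be the state with all spins up and, with $\sigma^+=(\sigma^x+i\sigma^y)/2$, let $$c_j=\Big(\bigotimes_{l=1}^{j-1}\sigma_l^z\Big)\otimes\sigma_j^+,\qquad b_q=\frac1{\sqrt N}\sum_{j=1}^N c_j e^{-iqj},\qquad a_q=\cos\theta_q\,b_q+i\sin\theta_q\,b_{-q}^\dagger ,$$ where $$\theta_q=\arctan\frac{|\sin\phi+\cos\phi\,e^{2iq}|-(\sin\phi+\cos\phi)\cos q}{(\cos\phi-\sin\phi)\sin q}\quad\text{if }\sin q\neq0,\qquad \theta_q=0\quad\text{if }\sin q=0.$$ Put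 $$|0^-\rangle=\prod_{\substack{q=2\pi k/N,\ k\in\mathbb Z\\ 0<q<\pi}}\big(\cos\theta_q-i\sin\theta_q\,b_q^\dagger b_{-q}^\dagger\big)|0\rangle,\qquad |\pm p\rangle=a_{\pm p}^\dagger|0^-\rangle ,$$ where $p=\frac\pi2\left(1-\frac1N\right)$ if $N\equiv1\pmod 4$ and $p=\frac\pi2\left(1+\frac1N\right)$ if $N\equiv3\pmod 4$, and let $$|\tilde g\rangle=\frac1{\sqrt2}\big(|p\rangle+e^{i\theta}\,\Pi^x|{-p}\rangle\big).$$ Then $|\tilde g\rangle$ is a normalized ground state of $H$ (an eigenvector for its smallest eigenvalue), the matrix elements $\langle p|\sigma_N^\gamma\Pi^\gamma|{-p}\rangle$, $\gamma=x,y$, are real, and for $\gamma=x,y$ and all $j=1,\dots,N$ $$\langle\tilde g|\sigma_j^\gamma|\tilde g\rangle=(-1)^j\cos\!\Big[\pi\frac jN+\lambda(\gamma,\theta,N)\Big]\,\langle p|\sigma_N^\gamma\Pi^\gamma|{-p}\rangle ,$$ where $\lambda(x,\theta,N)=(-1)^{(N-1)/2}\theta$ and $\lambda(y,\theta,N)=(-1)^{(N-1)/2}\theta+\frac\pi2$.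 -/

import Mathlib

open scoped Matrix

noncomputable section

namespace XYChain

/-- The two spin directions `x`, `y` of the coupling. -/
inductive Direction where
  | x
  | y

/-- A configuration of `N` spins in the `σᶻ` basis: `0` is spin up, `1` is spin down.
The index `j : Fin N` stands for the lattice site with number `j + 1`, so the sites are numbered
`1, …, N` and the last index is the site `N`. -/
abbrev Config (N : ℕ) : Type := Fin N → Fin 2

/-- State vectors of the chain, in the orthonormal basis of configurations. -/
abbrev State (N : ℕ) : Type := Config N → ℂ

/-- Linear operators on the `2 ^ N`-dimensional state space. -/
abbrev Op (N : ℕ) : Type := Matrix (Config N) (Config N) ℂ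

/-- The inner product `⟨u|v⟩`, conjugate linear in `u`. -/
def braket {N : ℕ} (u v : State N) : ℂ := star u ⬝ᵥ v

/-- The matrix element `⟨u|A|v⟩`. -/
def matrixElement {N : ℕ} (u : State N) (A : Op N) (v : State N) : ℂ := braket u (A *ᵥ v)

/-- The Pauli matrices `σˣ` and `σʸ`. -/
def pauli : Direction → Matrix (Fin 2) (Fin 2) ℂ
  | .x => !![0, 1; 1, 0]
  | .y => !![0, -Complex.I; Complex.I, 0]

/-- The Pauli matrix `σᶻ`. -/
def pauliZ : Matrix (Fin 2) (Fin 2) ℂ := !![1, 0; 0, -1]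

/-- The spin raising matrix `σ⁺ = (σˣ + i σʸ) / 2`. -/
def raising : Matrix (Fin 2) (Fin 2) ℂ :=
  (1 / 2 : ℂ) • (pauli .x + Complex.I • pauli .y)

/-- The tensor product `A₁ ⊗ ⋯ ⊗ A_N` of one-site operators. -/
def tensorOp {N : ℕ} (A : Fin N → Matrix (Fin 2) (Fin 2) ℂ) : Op N :=
  Matrix.of fun s t => ∏ i, A i (s i) (t i)

/-- The operator `σ_j^γ`: the Pauli matrix at site `j`, the identity at all other sites. -/
def spin {N : ℕ} (γ : Direction) (j : Fin N) : Op N :=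
  tensorOp fun i => if i = j then pauli γ else 1

/-- The parity operator `Π^γ = ⨂_j σ_j^γ`. -/
def parity (N : ℕ) (γ : Direction) : Op N := tensorOp fun _ => pauli γ

/-- The Hamiltonian `∑_j (cos φ σ_j^x σ_{j+1}^x + sin φ σ_j^y σ_{j+1}^y)` on a ring of `N` sites;
`finRotate N` sends each site to the next one and the last site to the first. -/
def hamiltonian (N : ℕ) (φ : ℝ) : Op N :=
  ∑ j : Fin N,
    ((Real.cos φ : ℂ) • (spin .x j * spin .x (finRotate N j)) +
      (Real.sin φ : ℂ) • (spin .y j * spin .y (finRotate N j)))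

/-- A ground state of `H`: a nonzero eigenvector for the smallest eigenvalue. -/
def IsGroundState {N : ℕ} (H : Op N) (v : State N) : Prop :=
  v ≠ 0 ∧ ∃ E : ℝ, H *ᵥ v = (E : ℂ) • v ∧
    ∀ (E' : ℝ) (w : State N), w ≠ 0 → H *ᵥ w = (E' : ℂ) • w → E ≤ E'

/-- The Jordan-Wigner annihilation operator
`c_j = σ_1^z ⊗ ⋯ ⊗ σ_{j-1}^z ⊗ σ_j^+ ⊗ 1 ⊗ ⋯ ⊗ 1`. -/
def jordanWigner {N : ℕ} (j : Fin N) : Op N :=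
  tensorOp fun i => if i < j then pauliZ else if i = j then raising else 1

/-- The Fourier transformed fermion `b_q = N^{-1/2} ∑_{j=1}^N c_j e^{-i q j}`. -/
def fourierMode (N : ℕ) (q : ℝ) : Op N :=
  (1 / (Real.sqrt N : ℂ)) •
    ∑ j : Fin N, Complex.exp (-Complex.I * (q : ℂ) * (((j : ℕ) + 1 : ℕ) : ℂ)) • jordanWigner j

/-- The Bogoliubov angle `θ_q`. It is set to `0` in the modes `q = 0, π` (mod `2π`), where
no rotation is made, that is, `a_q = b_q`. -/
def bogoliubovAngle (φ q : ℝ) : ℝ :=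
  if Real.sin q = 0 then 0
  else Real.arctan
    ((‖(Real.sin φ : ℂ) + (Real.cos φ : ℂ) * Complex.exp (Complex.I * (2 * q : ℝ))‖
        - (Real.sin φ + Real.cos φ) * Real.cos q) /
      ((Real.cos φ - Real.sin φ) * Real.sin q))

/-- The Bogoliubov fermion `a_q = cos θ_q b_q + i sin θ_q b_{-q}†`. -/
def bogoliubov (N : ℕ) (φ q : ℝ) : Op N :=
  (Real.cos (bogoliubovAngle φ q) : ℂ) • fourierMode N q +
    (Complex.I * (Real.sin (bogoliubovAngle φ q) : ℂ)) • (fourierMode N (-q))ᴴ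

/-- The state `|0⟩` with all spins up, the vacuum of the Jordan-Wigner fermions. -/
def allUp (N : ℕ) : State N := Pi.single (fun _ => 0) 1

/-- The Bogoliubov vacuum `|0⁻⟩ = ∏_q (cos θ_q - i sin θ_q b_q† b_{-q}†) |0⟩`, with the product
over the momenta `q = 2πk/N` in `(0, π)`, that is, `k = 1, …, ⌊(N-1)/2⌋`
(the factors commute). -/
def vacuumMinus (N : ℕ) (φ : ℝ) : State N :=
  ((List.range' 1 ((N - 1) / 2)).map fun k : ℕ =>
    (Real.cos (bogoliubovAngle φ (2 * Real.pi * k / N)) : ℂ) • (1 : Op N) -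
      (Complex.I * (Real.sin (bogoliubovAngle φ (2 * Real.pi * k / N)) : ℂ)) •
        ((fourierMode N (2 * Real.pi * k / N))ᴴ *
          (fourierMode N (-(2 * Real.pi * k / N)))ᴴ)).prod *ᵥ allUp N

/-- The one-particle state `|q⟩ = a_q† |0⁻⟩` of momentum `q ∈ Γ⁻ = {2πk/N}`. -/
def oneParticle (N : ℕ) (φ q : ℝ) : State N := (bogoliubov N φ q)ᴴ *ᵥ vacuumMinus N φ

/-- The momentum `p` of lowest energy, for odd `N`: `(π/2)(1 - 1/N)` if `N ≡ 1 (mod 4)` and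
`(π/2)(1 + 1/N)` if `N ≡ 3 (mod 4)`. -/
def groundMomentum (N : ℕ) : ℝ :=
  if N % 4 = 1 then Real.pi / 2 * (1 - 1 / N) else Real.pi / 2 * (1 + 1 / N)

/-- The state `|g̃⟩ = (|p⟩ + e^{iθ} Π^x |-p⟩) / √2`. -/
def tildeG (N : ℕ) (φ θ : ℝ) : State N :=
  (1 / (Real.sqrt 2 : ℂ)) •
    (oneParticle N φ (groundMomentum N) +
      Complex.exp (Complex.I * (θ : ℂ)) •
        (parity N .x *ᵥ oneParticle N φ (-groundMomentum N)))

/-- The phase `λ(γ, θ, N)`, for odd `N`. -/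
def phase (γ : Direction) (θ : ℝ) (N : ℕ) : ℝ :=
  match γ with
  | .x => (-1) ^ ((N - 1) / 2) * θ
  | .y => (-1) ^ ((N - 1) / 2) * θ + Real.pi / 2

end XYChain

end

/-! The Jordan-Wigner transformation turns the spin bonds into fermion bilinears. Only the bond from
site `N` to site `1` differs: it carries an extra factor `-Π^z`. In the sector `Π^z = -1` this
factor is `1`, so `H` acts there as a periodic quadratic chain (`hamiltonian_mulVec_of_odd`). Its
Fourier coefficient at momentum `q` is `cos φ e^{iq} + sin φ e^{-iq}`, and `2θ_q` is the argument of
this number (`dispersion_eq`), so the Bogoliubov rotation removes the phase and leaves `∑ ε_k (2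
a_k† a_k - 1)`, where `ε_k = |sin φ + cos φ e^{2iq}|` (`fermionHamiltonian_eq`).

Since `N` is odd, `Π^x` commutes with `H` and exchanges the two `Π^z` sectors, so the odd sector
contains every eigenvalue. The Bogoliubov vacuum is even, hence excluded from it, and it is the only
vector killed by all `a_k` (`eq_smul_vacuumMinus`). The lowest odd levels are therefore the
one-particle energies `2 ε_k - ∑ ε_l` (`exists_modeEnergy_le_of_eigenvector`). As `ε_k² = 1 + sin 2φ
cos 2q`, the minimum over the available momenta is at `±p` (`modeEnergy_groundMomentum_le`). Thus
`|p⟩` and `Π^x|-p⟩` are ground states of opposite parity, so they are orthogonal.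

In `⟨g̃|σ_j^γ|g̃⟩` the diagonal terms vanish because `σ_j^γ` reverses `Π^z`. What is left is the
real part of `e^{iθ}⟨p|σ_j^γ Π^x|-p⟩`, where `Π^x` may be replaced by a phase times `Π^γ`
(`parity_x_mulVec_of_odd`). Translation multiplies `⟨p|σ_j^γ Π^γ|-p⟩` by `e^{-2ip}` per site
(`flipElement_finRotate`), and reflection makes it real at site `N` (`flipElement_im`). Since `2p =
π ∓ π/N`, the phase `e^{-2ipj}` is `(-1)^j e^{±iπj/N}`, which gives the cosine profile (`re_phase`).
-/

open scoped Matrix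

noncomputable section

namespace XYChain

/-! ### Tensor products, site permutations, Pauli and parity algebra. -/

section

variable {N : ℕ}

lemma tensorOp_mul (A B : Fin N → Matrix (Fin 2) (Fin 2) ℂ) :
    tensorOp A * tensorOp B = tensorOp fun i => A i * B i := by
  ext s t
  simp only [tensorOp, Matrix.mul_apply, Matrix.of_apply, ← Finset.prod_mul_distrib]
  rw [Finset.prod_univ_sum]
  simp [Fintype.piFinset_univ]

lemma tensorOp_conjTranspose (A : Fin N → Matrix (Fin 2) (Fin 2) ℂ) :
    (tensorOp A)ᴴ = tensorOp fun i => (A i)ᴴ := by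
  ext s t
  simp [tensorOp, Matrix.conjTranspose_apply]

lemma tensorOp_one : tensorOp (fun _ : Fin N => 1) = 1 := by
  ext s t
  simp only [tensorOp, Matrix.of_apply, Matrix.one_apply]
  by_cases h : s = t
  · simp [h]
  · rw [if_neg h]
    obtain ⟨i, hi⟩ := Function.ne_iff.mp h
    exact Finset.prod_eq_zero (Finset.mem_univ i) (by simp [hi])

/-- Most commutation relations below come from a single site where the factors disagree by a scalar;
this lemma extracts that scalar. -/
lemma tensorOp_eq_smul {A B : Fin N → Matrix (Fin 2) (Fin 2) ℂ} (z : ℂ) (j : Fin N)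
    (hj : A j = z • B j) (h : ∀ i, i ≠ j → A i = B i) : tensorOp A = z • tensorOp B := by
  ext s t
  simp only [tensorOp, Matrix.of_apply, Matrix.smul_apply]
  rw [← Finset.mul_prod_erase _ _ (Finset.mem_univ j),
    ← Finset.mul_prod_erase _ (fun i => B i (s i) (t i)) (Finset.mem_univ j), hj,
    Finset.prod_congr rfl fun i hi => by rw [h i (Finset.ne_of_mem_erase hi)]]
  simp [mul_assoc]

lemma tensorOp_eq_add {A B C : Fin N → Matrix (Fin 2) (Fin 2) ℂ} (j : Fin N)
    (hj : A j = B j + C j) (hB : ∀ i, i ≠ j → A i = B i) (hC : ∀ i, i ≠ j → A i = C i) :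
    tensorOp A = tensorOp B + tensorOp C := by
  ext s t
  simp only [tensorOp, Matrix.of_apply, Matrix.add_apply]
  rw [← Finset.mul_prod_erase _ (fun i => A i (s i) (t i)) (Finset.mem_univ j),
    ← Finset.mul_prod_erase _ (fun i => B i (s i) (t i)) (Finset.mem_univ j),
    ← Finset.mul_prod_erase _ (fun i => C i (s i) (t i)) (Finset.mem_univ j), hj]
  rw [Finset.prod_congr (f := fun i => A i (s i) (t i)) (g := fun i => B i (s i) (t i)) rfl
      fun i hi => by rw [hB i (Finset.ne_of_mem_erase hi)],
    ← Finset.prod_congr (f := fun i => B i (s i) (t i)) (g := fun i => C i (s i) (t i)) rfl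
      fun i hi => by rw [← hB i (Finset.ne_of_mem_erase hi), hC i (Finset.ne_of_mem_erase hi)]]
  simp [add_mul]

lemma tensorOp_smul (z : ℂ) (A : Fin N → Matrix (Fin 2) (Fin 2) ℂ) :
    tensorOp (fun i => z • A i) = z ^ N • tensorOp A := by
  ext s t
  simp [tensorOp, Finset.prod_mul_distrib]

/-- The permutation of the tensor factors that moves site `i` to site `π i`. -/
def permOp (π : Equiv.Perm (Fin N)) : Op N :=
  Matrix.of fun s t => if s ∘ π = t then 1 else 0

lemma permOp_mul_apply (π : Equiv.Perm (Fin N)) (A : Op N) (s t : Config N) :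
    (permOp π * A) s t = A (s ∘ π) t := by
  simp [permOp, Matrix.mul_apply]

lemma mul_permOp_apply (π : Equiv.Perm (Fin N)) (A : Op N) (s t : Config N) :
    (A * permOp π) s t = A s (t ∘ π.symm) := by
  have h : ∀ u : Config N, u ∘ π = t ↔ u = t ∘ π.symm := fun u => by
    rw [Equiv.eq_comp_symm]
  simp [permOp, Matrix.mul_apply, h]

lemma permOp_mul_tensorOp (π : Equiv.Perm (Fin N)) (A : Fin N → Matrix (Fin 2) (Fin 2) ℂ) :
    permOp π * tensorOp A = tensorOp (fun i => A (π.symm i)) * permOp π := by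
  ext s t
  rw [permOp_mul_apply, mul_permOp_apply]
  simp only [tensorOp, Matrix.of_apply]
  rw [← Equiv.prod_comp π.symm]
  simp

lemma permOp_conjTranspose_mul (π : Equiv.Perm (Fin N)) : (permOp π)ᴴ * permOp π = 1 := by
  ext s t
  rw [mul_permOp_apply]
  simp [permOp, Matrix.conjTranspose_apply, Matrix.one_apply, Function.comp_assoc, eq_comm]

lemma permOp_mul_conjTranspose (π : Equiv.Perm (Fin N)) : permOp π * (permOp π)ᴴ = 1 :=
  mul_eq_one_comm.mp (permOp_conjTranspose_mul π)

lemma mulVec_allUp_apply (A : Op N) (s : Config N) : (A *ᵥ allUp N) s = A s 0 := by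
  have : allUp N = Pi.single 0 1 := rfl
  rw [this]
  simp

lemma permOp_mulVec_allUp (π : Equiv.Perm (Fin N)) : permOp π *ᵥ allUp N = allUp N := by
  ext s
  have h : s ∘ π = 0 ↔ s = 0 := by
    constructor
    · intro h
      ext i
      have := congrFun h (π.symm i)
      simpa using congrArg Fin.val this
    · rintro rfl; rfl
  have h0 : allUp N = Pi.single 0 1 := rfl
  rw [mulVec_allUp_apply, h0]
  simp [permOp, h, Pi.single_apply]

/-- The parity operator `Π^z = ⨂_j σ_j^z`. -/
def parityZ (N : ℕ) : Op N := tensorOp fun _ => pauliZ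

/-- The operator `σ_j^z`. -/
def spinZ (j : Fin N) : Op N := tensorOp fun i => if i = j then pauliZ else 1

lemma raising_eq : raising = !![0, 1; 0, 0] := by
  ext i j
  fin_cases i <;> fin_cases j <;> norm_num [raising, pauli]

lemma pauliZ_mul_pauliZ : pauliZ * pauliZ = 1 := by
  simp [pauliZ, Matrix.one_fin_two]

lemma pauliZ_conjTranspose : pauliZᴴ = pauliZ := by
  ext i j; fin_cases i <;> fin_cases j <;> simp [pauliZ]

lemma pauli_conjTranspose (γ : Direction) : (pauli γ)ᴴ = pauli γ := by
  ext i j; cases γ <;> fin_cases i <;> fin_cases j <;> simp [pauli]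

lemma pauli_mul_pauli (γ : Direction) : pauli γ * pauli γ = 1 := by
  cases γ <;> simp [pauli, Matrix.one_fin_two]

lemma pauliZ_mul_pauli (γ : Direction) : pauliZ * pauli γ = (-1 : ℂ) • (pauli γ * pauliZ) := by
  cases γ <;> simp [pauli, pauliZ]

lemma pauliZ_mul_raising : pauliZ * raising = raising := by
  ext i j; fin_cases i <;> fin_cases j <;> simp [raising_eq, pauliZ, Matrix.mul_apply]

lemma raising_mul_pauliZ : raising * pauliZ = (-1 : ℂ) • raising := by
  ext i j; fin_cases i <;> fin_cases j <;> simp [raising_eq, pauliZ, Matrix.mul_apply]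

lemma raising_conjTranspose : raisingᴴ = !![0, 0; 1, 0] := by
  ext i j; fin_cases i <;> fin_cases j <;> simp [raising_eq, Matrix.conjTranspose_apply]

lemma parityZ_mul_self : parityZ N * parityZ N = 1 := by
  simp [parityZ, tensorOp_mul, pauliZ_mul_pauliZ, tensorOp_one]

lemma parityZ_conjTranspose : (parityZ N)ᴴ = parityZ N := by
  simp [parityZ, tensorOp_conjTranspose, pauliZ_conjTranspose]

lemma spinZ_mul_self (j : Fin N) : spinZ j * spinZ j = 1 := by
  rw [spinZ, tensorOp_mul, ← tensorOp_one]
  congr 1; ext1 i; split_ifs <;> simp [pauliZ_mul_pauliZ]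

lemma parity_mul_self (γ : Direction) : parity N γ * parity N γ = 1 := by
  simp [parity, tensorOp_mul, pauli_mul_pauli, tensorOp_one]

lemma parity_conjTranspose (γ : Direction) : (parity N γ)ᴴ = parity N γ := by
  simp [parity, tensorOp_conjTranspose, pauli_conjTranspose]

lemma spin_conjTranspose (γ : Direction) (j : Fin N) : (spin γ j)ᴴ = spin γ j := by
  rw [spin, tensorOp_conjTranspose]
  congr 1; ext1 i; split_ifs <;> simp [pauli_conjTranspose]

lemma spin_mul_parity_comm (γ : Direction) (j : Fin N) :
    spin γ j * parity N γ = parity N γ * spin γ j := by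
  rw [spin, parity, tensorOp_mul, tensorOp_mul]
  congr 1; ext1 i; split_ifs <;> simp

lemma parityZ_mul_spin (γ : Direction) (j : Fin N) :
    parityZ N * spin γ j = -(spin γ j * parityZ N) := by
  rw [spin, parityZ, tensorOp_mul, tensorOp_mul, ← neg_one_smul ℂ]
  refine tensorOp_eq_smul _ j ?_ fun i hi => ?_
  · simpa using pauliZ_mul_pauli γ
  · simp [hi]

/-- Each site contributes a factor `-1`, and `(-1) ^ N = -1`. This is where odd `N` makes the two
parity sectors equivalent. -/
lemma parityZ_mul_parity (hN : Odd N) (γ : Direction) :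
    parityZ N * parity N γ = -(parity N γ * parityZ N) := by
  rw [parity, parityZ, tensorOp_mul, tensorOp_mul, ← neg_one_smul ℂ, ← hN.neg_one_pow (α := ℂ),
    ← tensorOp_smul]
  simp only [pauliZ_mul_pauli]

lemma parity_y_eq : parity N .y = Complex.I ^ N • (parity N .x * parityZ N) := by
  rw [parity, parity, parityZ, tensorOp_mul, ← tensorOp_smul]
  congr 1; ext1 _
  simp [pauli, pauliZ]

/-- A sign from `σ^y` passing `Π^x` occurs twice and cancels. -/
lemma parity_x_mul_spin_mul_spin (γ : Direction) (i j : Fin N) :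
    parity N .x * (spin γ i * spin γ j) = spin γ i * spin γ j * parity N .x := by
  have key : ∀ k : Fin N, parity N .x * spin γ k =
      (match γ with | .x => (1 : ℂ) | .y => -1) • (spin γ k * parity N .x) := by
    intro k
    rw [spin, parity, tensorOp_mul, tensorOp_mul]
    refine tensorOp_eq_smul _ k ?_ fun i hi => ?_
    · cases γ <;> simp [pauli]
    · simp [hi]
  rw [← mul_assoc, key, smul_mul_assoc, mul_assoc, key, mul_smul_comm, smul_smul]
  cases γ <;> simp [mul_assoc]

lemma hamiltonian_comm_parity_x (φ : ℝ) :
    parity N .x * hamiltonian N φ = hamiltonian N φ * parity N .x := by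
  simp only [hamiltonian, Finset.mul_sum, Finset.sum_mul, mul_add, add_mul, mul_smul_comm,
    smul_mul_assoc, parity_x_mul_spin_mul_spin]

lemma hamiltonian_comm_parityZ (φ : ℝ) :
    parityZ N * hamiltonian N φ = hamiltonian N φ * parityZ N := by
  have key : ∀ γ (i j : Fin N), parityZ N * (spin γ i * spin γ j) =
      spin γ i * spin γ j * parityZ N := by
    intro γ i j
    rw [← mul_assoc, parityZ_mul_spin, neg_mul, mul_assoc, parityZ_mul_spin, mul_neg, neg_neg,
      mul_assoc]
  simp only [hamiltonian, Finset.mul_sum, Finset.sum_mul, mul_add, add_mul, mul_smul_comm,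
    smul_mul_assoc, key]

lemma parityZ_mulVec_allUp : parityZ N *ᵥ allUp N = allUp N := by
  have h0 : allUp N = Pi.single 0 1 := rfl
  ext s
  rw [mulVec_allUp_apply, h0, Pi.single_apply]
  by_cases h : s = 0
  · simp [h, parityZ, tensorOp, pauliZ]
  · rw [if_neg h]
    obtain ⟨i, hi⟩ := Function.ne_iff.mp h
    have hi' : s i = 1 := by
      have : s i ≠ 0 := hi
      omega
    exact Finset.prod_eq_zero (Finset.mem_univ i) (by simp [hi', pauliZ])

lemma spinZ_mulVec_allUp (j : Fin N) : spinZ j *ᵥ allUp N = allUp N := by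
  have h0 : allUp N = Pi.single 0 1 := rfl
  ext s
  rw [mulVec_allUp_apply, h0, Pi.single_apply]
  by_cases h : s = 0
  · simp only [h, spinZ, tensorOp, if_true, Matrix.of_apply]
    refine Finset.prod_eq_one fun i _ => ?_
    split_ifs <;> simp [pauliZ]
  · rw [if_neg h]
    obtain ⟨i, hi⟩ := Function.ne_iff.mp h
    have hi' : s i = 1 := by
      have : s i ≠ 0 := hi
      omega
    refine Finset.prod_eq_zero (Finset.mem_univ i) ?_
    show (if i = j then pauliZ else 1) (s i) 0 = 0
    split_ifs <;> simp [hi', pauliZ]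

lemma jordanWigner_mulVec_allUp (j : Fin N) : jordanWigner j *ᵥ allUp N = 0 := by
  ext s
  rw [mulVec_allUp_apply]
  refine Finset.prod_eq_zero (Finset.mem_univ j) ?_
  have : ∀ a : Fin 2, raising a 0 = 0 := by
    intro a; fin_cases a <;> simp [raising_eq]
  simp [this]

/-- If `t` has a down spin at `j`, the component `v t` is, up to sign, the component of `c_j v` at
`t` with that spin raised, so it vanishes. -/
lemma eq_smul_allUp_of_jordanWigner_mulVec {v : State N}
    (h : ∀ j, jordanWigner j *ᵥ v = 0) : v = v 0 • allUp N := by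
  have h0 : allUp N = Pi.single 0 1 := rfl
  ext t
  by_cases ht : t = 0
  · simp [ht, h0]
  · obtain ⟨j, hj⟩ := Function.ne_iff.mp ht
    have hj' : t j = 1 := by
      have : t j ≠ 0 := hj
      omega
    have h1 := congrFun (h j) (Function.update t j 0)
    rw [Matrix.mulVec, dotProduct, Finset.sum_eq_single t] at h1
    · have h2 : jordanWigner j (Function.update t j 0) t ≠ 0 := by
        show (∏ i, (if i < j then pauliZ else if i = j then raising else 1)
          (Function.update t j 0 i) (t i) : ℂ) ≠ 0
        refine Finset.prod_ne_zero_iff.mpr fun i _ => ?_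
        by_cases hij : i = j
        · subst hij
          simp [hj', raising_eq]
        · have : ∀ a : Fin 2, pauliZ a a ≠ 0 := by
            intro a; fin_cases a <;> simp [pauliZ]
          simp only [Function.update_of_ne hij, hij, if_false]
          split_ifs <;> simp [this]
      have h3 : v t = 0 := (mul_eq_zero.mp h1).resolve_left h2
      simp [h3, h0, ht]
    · intro s _ hs
      obtain ⟨i, hi⟩ := Function.ne_iff.mp hs
      have : jordanWigner j (Function.update t j 0) s = 0 := by
        refine Finset.prod_eq_zero (Finset.mem_univ i) ?_
        by_cases hij : i = j
        · subst hij
          have hsi : s i = 0 := by rw [hj'] at hi; omega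
          simp [hsi, raising_eq]
        · have : ∀ a b : Fin 2, a ≠ b → pauliZ a b = 0 := by
            intro a b hab; fin_cases a <;> fin_cases b <;> simp_all [pauliZ]
          simp only [Function.update_of_ne hij, hij, if_false]
          split_ifs
          · exact this _ _ (Ne.symm hi)
          · exact Matrix.one_apply_ne (Ne.symm hi)
      simp [this]
    · simp

end

/-! ### Jordan-Wigner fermions and the bonds inside the chain. -/

section

variable {N : ℕ}

/-- The canonical anticommutation relations for a family of elements of a star algebra. -/
structure IsCAR {ι 𝒜 : Type*} [DecidableEq ι] [Ring 𝒜] [StarRing 𝒜] (c : ι → 𝒜) : Prop where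
  anticomm : ∀ i j, c i * c j + c j * c i = 0
  anticomm_star : ∀ i j, c i * star (c j) + star (c j) * c i = if i = j then 1 else 0

lemma jordanWigner_conjTranspose (j : Fin N) : (jordanWigner j)ᴴ =
    tensorOp fun i => if i < j then pauliZ else if i = j then raisingᴴ else 1 := by
  rw [jordanWigner, tensorOp_conjTranspose]
  congr 1; ext1 i; split_ifs <;> simp [pauliZ_conjTranspose]

lemma raising_mul_raising : raising * raising = 0 := by
  ext i j; fin_cases i <;> fin_cases j <;> simp [raising_eq, Matrix.mul_apply]

lemma pauliZ_mul_lowering : pauliZ * raisingᴴ = (-1 : ℂ) • raisingᴴ := by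
  ext i j; fin_cases i <;> fin_cases j <;>
    simp [raising_conjTranspose, pauliZ, Matrix.mul_apply]

lemma lowering_mul_pauliZ : raisingᴴ * pauliZ = raisingᴴ := by
  rw [raising_conjTranspose]
  ext i j; fin_cases i <;> fin_cases j <;>
    simp [pauliZ, Matrix.mul_apply]

/-- Only at site `i` do the factors fail to commute: there `A` meets the `σ^z` string of the other
operator. At site `j` the first operator is the identity, so `B` is arbitrary. -/
lemma jordanWigner_anticomm_of_lt {i j : Fin N} (h : i < j) (A B : Matrix (Fin 2) (Fin 2) ℂ)
    (hA : A * pauliZ = (-1 : ℂ) • (pauliZ * A)) :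
    tensorOp (fun l => if l < i then pauliZ else if l = i then A else 1) *
        tensorOp (fun l => if l < j then pauliZ else if l = j then B else 1) +
      tensorOp (fun l => if l < j then pauliZ else if l = j then B else 1) *
        tensorOp (fun l => if l < i then pauliZ else if l = i then A else 1) = 0 := by
  rw [tensorOp_mul, tensorOp_mul, ← eq_neg_iff_add_eq_zero, ← neg_one_smul ℂ]
  refine tensorOp_eq_smul _ i ?_ fun l hl => ?_
  · simpa [h] using hA
  · rcases lt_or_gt_of_ne hl with h1 | h1
    · simp [h1, h1.trans h]
    · simp [h1.not_gt, h1.ne']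

lemma raising_anticomm : raising * pauliZ = (-1 : ℂ) • (pauliZ * raising) := by
  rw [raising_mul_pauliZ, pauliZ_mul_raising]

lemma lowering_anticomm : raisingᴴ * pauliZ = (-1 : ℂ) • (pauliZ * raisingᴴ) := by
  rw [lowering_mul_pauliZ, pauliZ_mul_lowering, smul_smul]; simp

lemma isCAR_jordanWigner : IsCAR (jordanWigner : Fin N → Op N) where
  anticomm i j := by
    rcases lt_trichotomy i j with h | h | h
    · exact jordanWigner_anticomm_of_lt h _ _ raising_anticomm
    · subst h
      have : jordanWigner i * jordanWigner i = (0 : ℂ) • tensorOp (N := N)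
          fun l => if l = i then 0 else 1 := by
        rw [jordanWigner, tensorOp_mul]
        refine tensorOp_eq_smul _ i ?_ fun l hl => ?_
        · simp [raising_mul_raising]
        · simp only [hl, if_false]
          split_ifs <;> simp [pauliZ_mul_pauliZ]
      simp [this]
    · rw [add_comm]
      exact jordanWigner_anticomm_of_lt h _ _ raising_anticomm
  anticomm_star i j := by
    rw [Matrix.star_eq_conjTranspose]
    rcases lt_trichotomy i j with h | h | h
    · rw [if_neg h.ne, jordanWigner_conjTranspose]
      exact jordanWigner_anticomm_of_lt h _ _ raising_anticomm
    · subst h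
      rw [if_pos rfl, jordanWigner_conjTranspose, jordanWigner, tensorOp_mul, tensorOp_mul,
        ← tensorOp_one]
      symm
      refine tensorOp_eq_add i ?_ (fun l hl => ?_) (fun l hl => ?_)
      · rw [if_pos rfl]
        simp only [lt_irrefl, if_false, if_true, raising_conjTranspose]
        simp [raising_eq, Matrix.one_fin_two]
      · simp only [hl, if_false]
        split_ifs <;> simp [pauliZ_mul_pauliZ]
      · simp only [hl, if_false]
        split_ifs <;> simp [pauliZ_mul_pauliZ]
    · rw [if_neg h.ne', jordanWigner_conjTranspose, add_comm]
      exact jordanWigner_anticomm_of_lt h _ _ lowering_anticomm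

lemma parityZ_mul_jordanWigner (j : Fin N) :
    parityZ N * jordanWigner j = -(jordanWigner j * parityZ N) := by
  rw [jordanWigner, parityZ, tensorOp_mul, tensorOp_mul, ← neg_one_smul ℂ]
  refine tensorOp_eq_smul _ j ?_ fun i hi => ?_
  · simp [pauliZ_mul_raising, raising_mul_pauliZ]
  · simp only [hi, if_false]
    split_ifs <;> simp

lemma finRotate_val (j : Fin N) :
    (finRotate N j : ℕ) = if (j : ℕ) + 1 = N then 0 else (j : ℕ) + 1 := by
  cases N with
  | zero => exact j.elim0
  | succ n =>
    rw [coe_finRotate]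
    simp [Fin.ext_iff]

/-- The sum `c_j† + c_j`. -/
def majoranaA (j : Fin N) : Op N := (jordanWigner j)ᴴ + jordanWigner j

/-- The difference `c_j† - c_j`. -/
def majoranaD (j : Fin N) : Op N := (jordanWigner j)ᴴ - jordanWigner j

lemma majoranaA_eq (j : Fin N) :
    majoranaA j = tensorOp fun i => if i < j then pauliZ else if i = j then pauli .x else 1 := by
  symm
  rw [majoranaA, jordanWigner_conjTranspose, jordanWigner]
  refine tensorOp_eq_add j ?_ (fun l hl => ?_) (fun l hl => ?_)
  · simp [pauli, raising_eq, Matrix.conjTranspose]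
    ext a b; fin_cases a <;> fin_cases b <;> simp
  · simp [hl]
  · simp [hl]

lemma majoranaD_eq (j : Fin N) :
    majoranaD j = tensorOp fun i => if i < j then pauliZ else
      if i = j then -Complex.I • pauli .y else 1 := by
  rw [majoranaD, sub_eq_iff_eq_add, jordanWigner_conjTranspose, jordanWigner]
  refine tensorOp_eq_add j ?_ (fun l hl => ?_) (fun l hl => ?_)
  · simp [pauli, raising_eq, Matrix.conjTranspose]
    ext a b; fin_cases a <;> fin_cases b <;> simp
  · simp [hl]
  · simp [hl]

/-- The two strings cancel below `j`, and at `j` the leftover is `-i σ^y σ^z = σ^x`. -/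
lemma spin_x_mul_spin_x (j : Fin N) (hj : (j : ℕ) + 1 ≠ N) :
    spin .x j * spin .x (finRotate N j) = majoranaD j * majoranaA (finRotate N j) := by
  have h := finRotate_val j
  rw [if_neg hj] at h
  set k := finRotate N j
  rw [spin, spin, tensorOp_mul, majoranaA_eq, majoranaD_eq, tensorOp_mul]
  congr 1; ext1 i
  rcases lt_trichotomy i j with hi | hi | hi
  · have h1 : i < k := by rw [Fin.lt_def] at *; omega
    simp [hi, h1, hi.ne, h1.ne, pauliZ_mul_pauliZ]
  · have h1 : i < k := by rw [Fin.lt_def]; omega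
    simp [hi, hi ▸ h1, (hi ▸ h1).ne]
    simp [pauli, pauliZ]
  · have h1 : ¬ i < k := by rw [Fin.lt_def] at *; omega
    simp [h1, hi.ne', hi.not_gt]

lemma majoranaD_eq_smul (j : Fin N) :
    majoranaD j = -Complex.I • tensorOp fun i => if i < j then pauliZ else
      if i = j then pauli .y else 1 := by
  rw [majoranaD_eq]
  refine tensorOp_eq_smul _ j (by simp) fun i hi => by simp [hi]

lemma spin_y_mul_spin_y (j : Fin N) (hj : (j : ℕ) + 1 ≠ N) :
    spin .y j * spin .y (finRotate N j) = majoranaD (finRotate N j) * majoranaA j := by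
  have h := finRotate_val j
  rw [if_neg hj] at h
  set k := finRotate N j
  rw [spin, spin, tensorOp_mul, majoranaA_eq, majoranaD_eq_smul, smul_mul_assoc, tensorOp_mul]
  have h0 : j < k := by rw [Fin.lt_def]; omega
  refine tensorOp_eq_smul _ j ?_ fun i hij => ?_
  · simp [h0, h0.ne, pauli, pauliZ]
  have hi := lt_or_gt_of_ne hij
  rcases hi with hi | hi
  · have h1 : i < k := by rw [Fin.lt_def] at *; omega
    simp [hi, h1, hi.ne, h1.ne, pauliZ_mul_pauliZ]
  · have h1 : ¬ i < k := by rw [Fin.lt_def] at *; omega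
    simp [h1, hi.ne', hi.not_gt]

end

/-! ### The closing bond, reflection and translation of the fermions. -/

section

variable {N : ℕ}

/-- On the bond from `N` to `1` the string covers the ring and has to be undone by `Π^z`; commuting
`σ^z` past the operator at the first site gives the sign. -/
lemma spin_x_mul_spin_x_last (j : Fin N) (hj : (j : ℕ) + 1 = N) :
    spin .x j * spin .x (finRotate N j) =
      -(majoranaD j * majoranaA (finRotate N j) * parityZ N) := by
  have h := finRotate_val j
  rw [if_pos hj] at h
  set k := finRotate N j
  rw [spin, spin, tensorOp_mul, majoranaA_eq, majoranaD_eq, parityZ, tensorOp_mul, tensorOp_mul,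
    ← neg_one_smul ℂ]
  have hk : ∀ i, ¬ i < k := fun i => by rw [Fin.lt_def]; omega
  refine tensorOp_eq_smul _ k ?_ fun i hi => ?_
  -- Equality means a ring of one site, `N = 1`, where both ends of the bond coincide.
  · by_cases hkj : k = j
    · simp only [hkj, if_true, lt_irrefl, if_false]
      simp [pauli, pauliZ]
    · have h0 : k < j := by rw [Fin.lt_def]; rw [Fin.ext_iff] at hkj; omega
      simp [h0, h0.ne]
      simp [pauli, pauliZ]
  · rcases lt_trichotomy i j with h1 | h1 | h1
    · simp [h1, h1.ne, hi, hk, pauliZ_mul_pauliZ]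
    · subst h1
      simp [hi, hk]
      simp [pauli, pauliZ]
    · rw [Fin.lt_def] at h1; omega

lemma spin_y_mul_spin_y_last (j : Fin N) (hj : (j : ℕ) + 1 = N) :
    spin .y j * spin .y (finRotate N j) =
      -(majoranaD (finRotate N j) * majoranaA j * parityZ N) := by
  have h := finRotate_val j
  rw [if_pos hj] at h
  set k := finRotate N j
  rw [spin, spin, tensorOp_mul, majoranaA_eq, majoranaD_eq_smul, parityZ, smul_mul_assoc,
    tensorOp_mul, smul_mul_assoc, tensorOp_mul, neg_smul, neg_neg]
  have hk : ∀ i, ¬ i < k := fun i => by rw [Fin.lt_def]; omega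
  refine tensorOp_eq_smul _ j ?_ fun i hi => ?_
  · by_cases hkj : k = j
    · simp only [hkj, if_true, lt_irrefl, if_false]
      simp [pauli, pauliZ]
    · have h0 : ¬ j = k := fun h => hkj h.symm
      simp [h0, hk]
      simp [pauli, pauliZ]
  · have h1 : i < j := by
      rcases lt_or_gt_of_ne hi with h1 | h1
      · exact h1
      · rw [Fin.lt_def] at h1; omega
    simp only [h1, hi, hk, if_true, if_false]
    split_ifs <;> simp [pauliZ_mul_pauliZ, mul_assoc]

/-- The Hamiltonian of the chain of fermions with periodic boundary conditions. -/
def fermionHamiltonian (N : ℕ) (φ : ℝ) : Op N :=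
  ∑ j : Fin N,
    ((Real.cos φ : ℂ) • (majoranaD j * majoranaA (finRotate N j)) +
      (Real.sin φ : ℂ) • (majoranaD (finRotate N j) * majoranaA j))

lemma hamiltonian_mulVec_of_odd {v : State N} (hv : parityZ N *ᵥ v = -v) (φ : ℝ) :
    hamiltonian N φ *ᵥ v = fermionHamiltonian N φ *ᵥ v := by
  simp only [hamiltonian, fermionHamiltonian, Matrix.sum_mulVec, Matrix.add_mulVec,
    Matrix.smul_mulVec]
  refine Finset.sum_congr rfl fun j _ => ?_
  by_cases hj : (j : ℕ) + 1 = N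
  · rw [spin_x_mul_spin_x_last j hj, spin_y_mul_spin_y_last j hj]
    simp only [Matrix.neg_mulVec, ← Matrix.mulVec_mulVec (v := v) (M := _ * _), hv,
      Matrix.mulVec_neg, neg_neg]
  · rw [spin_x_mul_spin_x j hj, spin_y_mul_spin_y j hj]

lemma permOp_mul_spin (π : Equiv.Perm (Fin N)) (γ : Direction) (j : Fin N) :
    permOp π * spin γ j = spin γ (π j) * permOp π := by
  rw [spin, permOp_mul_tensorOp, spin]
  simp only [Equiv.symm_apply_eq]

lemma permOp_mul_parity (π : Equiv.Perm (Fin N)) (γ : Direction) :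
    permOp π * parity N γ = parity N γ * permOp π := permOp_mul_tensorOp _ _

lemma permOp_mul_parityZ (π : Equiv.Perm (Fin N)) :
    permOp π * parityZ N = parityZ N * permOp π := permOp_mul_tensorOp _ _

/-- Reflection moves the string to the sites above `j.rev`. Multiplication by `Π^z` replaces it by
the string below, and `σ^z σ^+ = σ^+` leaves the site itself alone. -/
lemma reflection_mul_jordanWigner (j : Fin N) :
    permOp Fin.revPerm * jordanWigner j =
      parityZ N * jordanWigner j.rev * permOp Fin.revPerm := by
  rw [jordanWigner, permOp_mul_tensorOp, parityZ, jordanWigner, tensorOp_mul]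
  congr 2; ext1 i
  simp only [Fin.revPerm_symm, Fin.revPerm_apply]
  rcases lt_trichotomy i j.rev with h | h | h
  · have h1 : ¬ i.rev < j := by rw [Fin.rev_lt_iff]; exact h.not_gt
    have h2 : i.rev ≠ j := fun h2 => by rw [← h2, Fin.rev_rev] at h; exact lt_irrefl _ h
    simp [h, h1, h2, pauliZ_mul_pauliZ]
  · subst h
    simp [pauliZ_mul_raising]
  · have h1 : i.rev < j := by rw [Fin.rev_lt_iff]; exact h
    simp [h1, h.ne', h.not_gt]

lemma revPerm_permOp_conjTranspose :
    (permOp Fin.revPerm : Op N)ᴴ = permOp Fin.revPerm := by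
  ext s t
  have : t ∘ Fin.revPerm = s ↔ s ∘ Fin.revPerm = t := by
    constructor
    · rintro rfl; ext1; simp
    · rintro rfl; ext1; simp
  simp [permOp, Matrix.conjTranspose_apply, this]

lemma reflection_mul_jordanWigner_conjTranspose (j : Fin N) :
    permOp Fin.revPerm * (jordanWigner j)ᴴ =
      (jordanWigner j.rev)ᴴ * parityZ N * permOp Fin.revPerm := by
  have hR : (permOp Fin.revPerm : Op N) * permOp Fin.revPerm = 1 := by
    simpa [revPerm_permOp_conjTranspose] using permOp_mul_conjTranspose (N := N) Fin.revPerm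
  have h := congrArg Matrix.conjTranspose (reflection_mul_jordanWigner j)
  simp only [Matrix.conjTranspose_mul, revPerm_permOp_conjTranspose, parityZ_conjTranspose] at h
  have h2 := congrArg (fun A => permOp Fin.revPerm * A * permOp Fin.revPerm) h
  simp only [mul_assoc, hR, mul_one] at h2
  simp only [← mul_assoc, hR, one_mul] at h2
  exact h2

lemma parityZ_mul_spinZ (j : Fin N) : parityZ N * spinZ j = spinZ j * parityZ N := by
  rw [spinZ, parityZ, tensorOp_mul, tensorOp_mul]
  congr 1; ext1 i; split_ifs <;> simp

lemma parityZ_mul_string (A : Matrix (Fin 2) (Fin 2) ℂ)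
    (hA : A * pauliZ = (-1 : ℂ) • (pauliZ * A)) (j : Fin N) :
    parityZ N * tensorOp (fun l => if l < j then pauliZ else if l = j then A else 1) =
      -(tensorOp (fun l => if l < j then pauliZ else if l = j then A else 1) * parityZ N) := by
  have hA' : pauliZ * A = (-1 : ℂ) • (A * pauliZ) := by rw [hA, smul_smul]; simp
  rw [parityZ, tensorOp_mul, tensorOp_mul, ← neg_one_smul ℂ]
  refine tensorOp_eq_smul _ j ?_ fun i hi => ?_
  · simpa using hA'
  · simp only [hi, if_false]
    split_ifs <;> simp

/-- `C` exchanges the ranges of `1 + P` and `1 - P`, so the factor `Z` is present on exactly one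
side of `C`, and there it cancels the `Z` produced by `T`. -/
lemma untwisted_intertwine {𝒜 : Type*} [Ring 𝒜] {T P Z C C' : 𝒜} (hZZ : Z * Z = 1)
    (hT : T * C = Z * C' * T) (hP : P * C = -(C * P)) (hZ : Z * C' = C' * Z) :
    (T * (1 - P) + Z * T * (1 + P)) * C = C' * (T * (1 - P) + Z * T * (1 + P)) := by
  have e1 : (1 - P) * C = C * (1 + P) := by rw [sub_mul, hP, mul_add]; simp
  have e2 : (1 + P) * C = C * (1 - P) := by rw [add_mul, hP, mul_sub]; simp [sub_eq_add_neg]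
  have e5 : (T * (1 - P) + Z * T * (1 + P)) * C = T * C * (1 + P) + Z * (T * C) * (1 - P) := by
    rw [add_mul, mul_assoc, e1, mul_assoc (Z * T), e2]; simp only [mul_assoc]
  have e6 : C' * (T * (1 - P) + Z * T * (1 + P)) = C' * Z * T * (1 + P) + C' * T * (1 - P) := by
    rw [mul_add, add_comm]; simp only [mul_assoc]
  rw [e5, e6, hT, ← hZ]
  simp only [← mul_assoc, hZZ, one_mul]

lemma twisted_intertwine {𝒜 : Type*} [Ring 𝒜] {T P Z C C' : 𝒜} (hPZ : P * Z = Z * P)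
    (hPT : T * P = P * T) (hPP : P * P = 1) (hZZ : Z * Z = 1) (hT : T * C = P * Z * C' * T)
    (hP : P * C = -(C * P)) (hP' : P * C' = -(C' * P)) (hZ : Z * C' = -(C' * Z)) :
    (T * (1 - P) + Z * T * (1 + P)) * C = C' * (T * (1 - P) + Z * T * (1 + P)) := by
  have e1 : (1 - P) * C = C * (1 + P) := by rw [sub_mul, hP, mul_add]; simp
  have e2 : (1 + P) * C = C * (1 - P) := by rw [add_mul, hP, mul_sub]; simp [sub_eq_add_neg]
  have e5 : (T * (1 - P) + Z * T * (1 + P)) * C = T * C * (1 + P) + Z * (T * C) * (1 - P) := by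
    rw [add_mul, mul_assoc, e1, mul_assoc (Z * T), e2]; simp only [mul_assoc]
  have e6 : C' * (T * (1 - P) + Z * T * (1 + P)) = C' * Z * T * (1 + P) + C' * T * (1 - P) := by
    rw [mul_add, add_comm]; simp only [mul_assoc]
  rw [e5, e6, hT]
  have e3 : P * (1 - P) = -(1 - P) := by rw [mul_sub, hPP]; simp
  have e4 : P * (1 + P) = 1 + P := by rw [mul_add, hPP]; simp [add_comm]
  refine congrArg₂ (· + ·) ?_ ?_
  · calc P * Z * C' * T * (1 + P) = Z * (P * C') * T * (1 + P) := by
          rw [hPZ]; simp only [mul_assoc]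
      _ = -(Z * C' * (P * T) * (1 + P)) := by rw [hP']; simp [mul_assoc]
      _ = -(Z * C' * T * (P * (1 + P))) := by rw [← hPT]; simp [mul_assoc]
      _ = C' * Z * T * (1 + P) := by rw [e4, hZ]; simp [mul_assoc]
  · calc Z * (P * Z * C' * T) * (1 - P) = (Z * Z) * (P * C') * T * (1 - P) := by
          rw [hPZ]; simp only [mul_assoc]
      _ = -(C' * (P * T) * (1 - P)) := by rw [hZZ, hP']; simp [mul_assoc]
      _ = -(C' * T * (P * (1 - P))) := by rw [← hPT]; simp [mul_assoc]
      _ = C' * T * (1 - P) := by rw [e3, mul_neg, neg_neg]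

section Translation

variable [NeZero N]

lemma finRotate_eq_zero_iff (j : Fin N) : finRotate N j = 0 ↔ (j : ℕ) + 1 = N := by
  rw [Fin.ext_iff, finRotate_val]
  split_ifs with h <;> simp [h]

/-- A shifted string starts at site `2`; the missing `σ^z` at site `1` is the factor `spinZ 0`. From
site `N` the operator lands on site `1`, and the string left behind has to be compensated by `Π^z`.
-/
lemma translation_mul_string (A : Matrix (Fin 2) (Fin 2) ℂ) (j : Fin N) :
    permOp (finRotate N) * tensorOp (fun l => if l < j then pauliZ else if l = j then A else 1) =
      (if (j : ℕ) + 1 = N then parityZ N else 1) * spinZ 0 *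
        tensorOp (fun l => if l < finRotate N j then pauliZ else
          if l = finRotate N j then A else 1) * permOp (finRotate N) := by
  rw [permOp_mul_tensorOp]
  congr 1
  have hj := finRotate_val j
  split_ifs with hN
  · rw [if_pos hN] at hj
    rw [spinZ, parityZ, tensorOp_mul, tensorOp_mul]
    congr 1; ext1 i
    obtain ⟨l, rfl⟩ := (finRotate N).surjective i
    have h0 : finRotate N j = 0 := (finRotate_eq_zero_iff j).2 hN
    simp only [Equiv.symm_apply_apply, EmbeddingLike.apply_eq_iff_eq]
    by_cases hl : l = j
    · subst hl; simp [h0, pauliZ_mul_pauliZ]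
    · have h1 : l < j := by rw [Fin.lt_def]; rw [Fin.ext_iff] at hl; omega
      have h2 : finRotate N l ≠ 0 := by rw [← h0]; simpa [-finRotate_apply] using hl
      simp [-finRotate_apply, hl, h1, h0, h2]
  · rw [if_neg hN] at hj
    rw [spinZ, one_mul, tensorOp_mul]
    congr 1; ext1 i
    obtain ⟨l, rfl⟩ := (finRotate N).surjective i
    have hl := finRotate_val l
    simp only [Equiv.symm_apply_apply, EmbeddingLike.apply_eq_iff_eq]
    by_cases hlN : (l : ℕ) + 1 = N
    · have h0 : finRotate N l = 0 := (finRotate_eq_zero_iff l).2 hlN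
      have h1 : ¬ l < j := by rw [Fin.lt_def]; omega
      have h2 : l ≠ j := by rintro rfl; exact hN hlN
      have h3 : 0 < finRotate N j := by rw [Fin.lt_def, hj]; simp
      simp [-finRotate_apply, h0, h1, h2, h3, pauliZ_mul_pauliZ]
    · have h0 : finRotate N l ≠ 0 := fun h => hlN ((finRotate_eq_zero_iff l).1 h)
      rw [if_neg hlN] at hl
      have h1 : finRotate N l < finRotate N j ↔ l < j := by
        rw [Fin.lt_def, Fin.lt_def]; omega
      simp [-finRotate_apply, h0, h1]

/-- The translation of the fermions by one site. -/
def fermionShift (N : ℕ) [NeZero N] : Op N :=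
  (1 / 2 : ℂ) • (permOp (finRotate N) * (1 - parityZ N) +
    spinZ 0 * permOp (finRotate N) * (1 + parityZ N))

lemma spinZ_zero_mul_string (A : Matrix (Fin 2) (Fin 2) ℂ)
    (hA : A * pauliZ = (-1 : ℂ) • (pauliZ * A)) (j : Fin N) :
    spinZ 0 * tensorOp (fun l => if l < j then pauliZ else if l = j then A else 1) =
      (if j = 0 then -1 else 1 : ℂ) •
        (tensorOp (fun l => if l < j then pauliZ else if l = j then A else 1) * spinZ 0) := by
  have hA' : pauliZ * A = (-1 : ℂ) • (A * pauliZ) := by rw [hA, smul_smul]; simp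
  rw [spinZ, tensorOp_mul, tensorOp_mul]
  refine tensorOp_eq_smul _ 0 ?_ fun i hi => ?_
  · by_cases h : j = 0
    · subst h
      simpa using hA'
    · have : 0 < j := Fin.pos_iff_ne_zero.mpr h
      simp [h, this]
  · simp [hi]

/-- Bare translation moves fermions only up to strings. Correcting it by `σ_1^z` on the even sector
makes it a cyclic shift for all sites, the last included, while on the odd sector it remains the
bare translation. -/
lemma fermionShift_mul_string (A : Matrix (Fin 2) (Fin 2) ℂ)
    (hA : A * pauliZ = (-1 : ℂ) • (pauliZ * A)) (j : Fin N) :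
    fermionShift N * tensorOp (fun l => if l < j then pauliZ else if l = j then A else 1) =
      tensorOp (fun l => if l < finRotate N j then pauliZ else
          if l = finRotate N j then A else 1) * fermionShift N := by
  have hT := translation_mul_string A j
  have hZ := spinZ_zero_mul_string A hA (finRotate N j)
  have hP := parityZ_mul_string A hA j
  have hP' := parityZ_mul_string A hA (finRotate N j)
  have hPZ := parityZ_mul_spinZ (0 : Fin N)
  have hPT := permOp_mul_parityZ (finRotate N)
  have hPP := parityZ_mul_self (N := N)
  have hZZ := spinZ_mul_self (0 : Fin N)
  simp only [finRotate_eq_zero_iff] at hZ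
  rw [fermionShift, smul_mul_assoc, mul_smul_comm]
  refine congrArg _ ?_
  by_cases hj : (j : ℕ) + 1 = N
  · rw [if_pos hj] at hZ hT
    rw [neg_one_smul] at hZ
    exact twisted_intertwine hPZ hPT hPP hZZ hT hP hP' hZ
  · rw [if_neg hj] at hZ hT
    rw [one_smul] at hZ
    rw [one_mul] at hT
    exact untwisted_intertwine hZZ hT hP hZ

lemma fermionShift_mul_jordanWigner (j : Fin N) :
    fermionShift N * jordanWigner j = jordanWigner (finRotate N j) * fermionShift N :=
  fermionShift_mul_string _ raising_anticomm j

lemma fermionShift_mul_jordanWigner_conjTranspose (j : Fin N) :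
    fermionShift N * (jordanWigner j)ᴴ = (jordanWigner (finRotate N j))ᴴ * fermionShift N := by
  simpa only [jordanWigner_conjTranspose] using fermionShift_mul_string _ lowering_anticomm j

lemma fermionShift_mulVec_allUp : fermionShift N *ᵥ allUp N = allUp N := by
  simp only [fermionShift, Matrix.smul_mulVec, Matrix.add_mulVec, ← Matrix.mulVec_mulVec,
    Matrix.sub_mulVec, Matrix.one_mulVec, parityZ_mulVec_allUp, sub_self, Matrix.mulVec_zero,
    Matrix.mulVec_add, permOp_mulVec_allUp, spinZ_mulVec_allUp, zero_add]
  ext s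
  simp
  ring

lemma fermionShift_mulVec_of_odd {v : State N} (hv : parityZ N *ᵥ v = -v) :
    fermionShift N *ᵥ v = permOp (finRotate N) *ᵥ v := by
  simp only [fermionShift, Matrix.smul_mulVec, Matrix.add_mulVec, ← Matrix.mulVec_mulVec,
    Matrix.sub_mulVec, Matrix.one_mulVec, hv, sub_neg_eq_add, Matrix.mulVec_zero,
    Matrix.mulVec_add, add_neg_cancel, add_zero]
  ext s
  simp
  ring

end Translation

end

section

/-! ### Canonical anticommutation relations and the Bogoliubov transformation, abstractly. -/

section Fermions

open Complex

variable {𝒜 : Type*} [Ring 𝒜] [StarRing 𝒜] [Algebra ℂ 𝒜] [StarModule ℂ 𝒜]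

section

variable {ι : Type*} [DecidableEq ι] {c : ι → 𝒜}

omit [Algebra ℂ 𝒜] [StarModule ℂ 𝒜] in
lemma IsCAR.star_anticomm (h : IsCAR c) (i j : ι) :
    star (c i) * star (c j) + star (c j) * star (c i) = 0 := by
  rw [← star_mul, ← star_mul, ← star_add, add_comm, h.anticomm i j, star_zero]

omit [StarModule ℂ 𝒜] in
lemma IsCAR.mul_self (h : IsCAR c) (i : ι) : c i * c i = 0 := by
  have h2 : (2 : ℂ) • (c i * c i) = 0 := by rw [two_smul]; exact h.anticomm i i
  simpa using h2

omit [StarModule ℂ 𝒜] in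
lemma IsCAR.star_mul_self (h : IsCAR c) (i : ι) : star (c i) * star (c i) = 0 := by
  rw [← star_mul, h.mul_self, star_zero]

lemma IsCAR.unitary {κ : Type*} [DecidableEq κ] [Fintype ι] (h : IsCAR c) (u : κ → ι → ℂ)
    (hu : ∀ k l, ∑ i, u k i * star (u l i) = if k = l then 1 else 0) :
    IsCAR fun k => ∑ i, u k i • c i where
  anticomm k l := by
    simp only [Finset.sum_mul_sum, smul_mul_smul_comm]
    rw [Finset.sum_comm (s := Finset.univ) (t := Finset.univ)
      (f := fun i j => (u l i * u k j) • (c i * c j)), ← Finset.sum_add_distrib]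
    refine Finset.sum_eq_zero fun i _ => ?_
    rw [← Finset.sum_add_distrib]
    refine Finset.sum_eq_zero fun j _ => ?_
    rw [mul_comm (u l j), ← smul_add, h.anticomm, smul_zero]
  anticomm_star k l := by
    simp only [star_sum, star_smul, Finset.sum_mul_sum, smul_mul_smul_comm]
    rw [Finset.sum_comm (s := Finset.univ) (t := Finset.univ)
      (f := fun i j => (star (u l i) * u k j) • (star (c i) * c j)), ← Finset.sum_add_distrib]
    have : ∀ i, ∑ j, (u k i * star (u l j)) • (c i * star (c j)) +
        ∑ j, (star (u l j) * u k i) • (star (c j) * c i) = (u k i * star (u l i)) • 1 := by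
      intro i
      rw [← Finset.sum_add_distrib, Finset.sum_eq_single i]
      · rw [mul_comm (star (u l i)), ← smul_add, h.anticomm_star, if_pos rfl]
      · intro j _ hj
        rw [mul_comm (star (u l j)), ← smul_add, h.anticomm_star, if_neg hj.symm, smul_zero]
      · simp
    simp only [this, ← Finset.sum_smul, hu]
    split_ifs <;> simp

end

variable {G : Type*} [AddCommGroup G] [DecidableEq G]

/-- The Bogoliubov transform `cos θ_k b_k + i sin θ_k b_{-k}†` of a family of fermions. -/
def bogoliubovTransform (θ : G → ℝ) (b : G → 𝒜) (k : G) : 𝒜 :=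
  (Real.cos (θ k) : ℂ) • b k + (I * (Real.sin (θ k) : ℂ)) • star (b (-k))

/-- The factor `cos θ_k - i sin θ_k b_k† b_{-k}†` of the Bogoliubov vacuum. -/
def pairFactor (θ : G → ℝ) (b : G → 𝒜) (k : G) : 𝒜 :=
  (Real.cos (θ k) : ℂ) • 1 - (I * (Real.sin (θ k) : ℂ)) • (star (b k) * star (b (-k)))

variable {θ : G → ℝ} {b : G → 𝒜}

omit [DecidableEq G] in
lemma star_bogoliubovTransform (k : G) : star (bogoliubovTransform θ b k) =
    (Real.cos (θ k) : ℂ) • star (b k) - (I * (Real.sin (θ k) : ℂ)) • b (-k) := by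
  simp [bogoliubovTransform, sub_eq_add_neg, -ofReal_cos, -ofReal_sin]

/-- Oddness of `θ` cancels the two mixed terms of the anticommutator of `a_k` and `a_{-k}`; the
relation with the adjoint uses `cos² + sin² = 1`. -/
lemma IsCAR.bogoliubov (h : IsCAR b) (hθ : ∀ k, θ (-k) = -θ k) :
    IsCAR (bogoliubovTransform θ b) where
  anticomm k l := by
    have h1 : bogoliubovTransform θ b k * bogoliubovTransform θ b l +
        bogoliubovTransform θ b l * bogoliubovTransform θ b k =
        ((Real.cos (θ k) : ℂ) * Real.cos (θ l)) • (b k * b l + b l * b k) +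
        ((Real.cos (θ k) : ℂ) * (I * Real.sin (θ l))) •
          (b k * star (b (-l)) + star (b (-l)) * b k) +
        ((I * Real.sin (θ k)) * (Real.cos (θ l) : ℂ)) •
          (b l * star (b (-k)) + star (b (-k)) * b l) +
        ((I * Real.sin (θ k)) * (I * Real.sin (θ l))) •
          (star (b (-k)) * star (b (-l)) + star (b (-l)) * star (b (-k))) := by
      simp only [bogoliubovTransform, add_mul, mul_add, smul_mul_smul_comm]
      module
    rw [h1, h.anticomm, h.star_anticomm, h.anticomm_star, h.anticomm_star]
    by_cases hkl : k = -l
    · have hl : l = -k := by rw [hkl, neg_neg]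
      rw [if_pos hkl, if_pos hl, hkl, hθ, Real.sin_neg, Real.cos_neg]
      push_cast
      module
    · have hl : ¬ l = -k := fun h => hkl (by rw [h, neg_neg])
      simp [hkl, hl]
  anticomm_star k l := by
    have h1 : bogoliubovTransform θ b k * star (bogoliubovTransform θ b l) +
        star (bogoliubovTransform θ b l) * bogoliubovTransform θ b k =
        ((Real.cos (θ k) : ℂ) * Real.cos (θ l)) • (b k * star (b l) + star (b l) * b k) -
        ((Real.cos (θ k) : ℂ) * (I * Real.sin (θ l))) •
          (b k * b (-l) + b (-l) * b k) +
        ((I * Real.sin (θ k)) * (Real.cos (θ l) : ℂ)) •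
          (star (b (-k)) * star (b l) + star (b l) * star (b (-k))) -
        ((I * Real.sin (θ k)) * (I * Real.sin (θ l))) •
          (b (-l) * star (b (-k)) + star (b (-k)) * b (-l)) := by
      rw [star_bogoliubovTransform]
      simp only [bogoliubovTransform, add_mul, mul_add, sub_mul, mul_sub, smul_mul_smul_comm]
      module
    rw [h1, h.anticomm, h.star_anticomm, h.anticomm_star, h.anticomm_star]
    by_cases hkl : k = l
    · subst hkl
      have h2 : (Real.cos (θ k) : ℂ) * Real.cos (θ k) - I * Real.sin (θ k) * (I * Real.sin (θ k))
          = 1 := by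
        have := congrArg ((↑) : ℝ → ℂ) (Real.cos_sq_add_sin_sq (θ k))
        push_cast at this ⊢
        linear_combination this - (sin (θ k)) ^ 2 * I_sq
      simp only [if_true, smul_zero, add_zero, sub_zero, ← sub_smul, h2, one_smul]
    · have hl : ¬ -l = -k := fun h => hkl (neg_injective h).symm
      simp [hkl, hl]

omit [StarModule ℂ 𝒜] in
lemma IsCAR.pairFactor_neg (h : IsCAR b) (hθ : ∀ k, θ (-k) = -θ k) (k : G) :
    pairFactor θ b (-k) = pairFactor θ b k := by
  have h1 := eq_neg_of_add_eq_zero_left (h.star_anticomm (-k) k)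
  simp [pairFactor, hθ, h1]

-- Moving `b_k` past the pair `b_k† b_{-k}†` leaves a term `-i sin θ cos θ b_{-k}†`, which the
-- creation part of `a_k` cancels. Hence the pair factor carries the vacuum of `b_k` to that of
-- `a_k`.
omit [StarModule ℂ 𝒜] in
lemma IsCAR.bogoliubovTransform_mul_pairFactor (h : IsCAR b) {k : G} (hk : k ≠ -k) :
    bogoliubovTransform θ b k * pairFactor θ b k =
      (Real.cos (θ k) : ℂ) • (pairFactor θ b k * b k) := by
  have h1 : b k * (star (b k) * star (b (-k))) =
      star (b (-k)) + star (b k) * star (b (-k)) * b k := by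
    have e1 := h.anticomm_star k k
    have e2 := h.anticomm_star k (-k)
    rw [if_pos rfl] at e1
    rw [if_neg hk] at e2
    rw [← mul_assoc, eq_sub_of_add_eq e1, mul_assoc (star (b k)) (star (b (-k))),
      eq_neg_of_add_eq_zero_right e2]
    noncomm_ring
  have h2 : star (b (-k)) * (star (b k) * star (b (-k))) = 0 := by
    rw [← mul_assoc, eq_neg_of_add_eq_zero_left (h.star_anticomm (-k) k), neg_mul, mul_assoc,
      h.star_mul_self, mul_zero, neg_zero]
  simp only [bogoliubovTransform, pairFactor, add_mul, mul_sub, sub_mul, smul_mul_assoc,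
    mul_smul_comm, mul_one, one_mul, h1, h2]
  module

omit [StarModule ℂ 𝒜] in
lemma IsCAR.bogoliubovTransform_neg_mul_pairFactor (h : IsCAR b) (hθ : ∀ k, θ (-k) = -θ k)
    {k : G} (hk : k ≠ -k) :
    bogoliubovTransform θ b (-k) * pairFactor θ b k =
      (Real.cos (θ k) : ℂ) • (pairFactor θ b k * b (-k)) := by
  have := h.bogoliubovTransform_mul_pairFactor (θ := θ) (k := -k) (by simpa using hk.symm)
  rwa [h.pairFactor_neg hθ, hθ, Real.cos_neg] at this

omit [StarRing 𝒜] [Algebra ℂ 𝒜] [StarModule ℂ 𝒜] in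
lemma commute_mul_of_anticomm {x y z : 𝒜} (hy : x * y + y * x = 0) (hz : x * z + z * x = 0) :
    Commute x (y * z) := by
  rw [commute_iff_eq, ← mul_assoc, eq_neg_of_add_eq_zero_left hy, mul_assoc y z,
    eq_neg_of_add_eq_zero_right hz]
  noncomm_ring

omit [DecidableEq G] [StarModule ℂ 𝒜] in
lemma commute_pairFactor {x : 𝒜} {k : G} (h : Commute x (star (b k) * star (b (-k)))) :
    Commute x (pairFactor θ b k) :=
  ((Commute.one_right x).smul_right _).sub_right (h.smul_right _)

omit [StarModule ℂ 𝒜] in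
lemma IsCAR.commute_pairFactor (h : IsCAR b) {m k : G} (h1 : m ≠ k) (h2 : m ≠ -k) :
    Commute (b m) (pairFactor θ b k) := by
  refine XYChain.commute_pairFactor (commute_mul_of_anticomm ?_ ?_)
  · simpa [h1] using h.anticomm_star m k
  · simpa [h2] using h.anticomm_star m (-k)

omit [StarModule ℂ 𝒜] in
lemma IsCAR.star_commute_pairFactor (h : IsCAR b) (m k : G) :
    Commute (star (b m)) (pairFactor θ b k) :=
  XYChain.commute_pairFactor
    (commute_mul_of_anticomm (h.star_anticomm _ _) (h.star_anticomm _ _))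

omit [StarModule ℂ 𝒜] in
lemma IsCAR.bogoliubovTransform_commute_pairFactor (h : IsCAR b) {m k : G} (h1 : m ≠ k)
    (h2 : m ≠ -k) : Commute (bogoliubovTransform θ b m) (pairFactor θ b k) :=
  ((h.commute_pairFactor h1 h2).smul_left _).add_left
    ((h.star_commute_pairFactor _ _).smul_left _)

-- The pair `b_k† b_{-k}†` squares to zero, so the difference of squares leaves only the scalar.
-- This makes pair factors invertible when `cos θ_k ≠ 0`.
omit [StarModule ℂ 𝒜] in
lemma IsCAR.pairFactor_mul_pairFactor_neg (h : IsCAR b) (k : G) :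
    pairFactor θ b k * pairFactor (-θ) b k = (Real.cos (θ k) : ℂ) ^ 2 • 1 := by
  have h1 : star (b k) * star (b (-k)) * (star (b k) * star (b (-k))) = 0 := by
    rw [mul_assoc, ← mul_assoc (star (b (-k))),
      eq_neg_of_add_eq_zero_left (h.star_anticomm (-k) k), neg_mul, mul_assoc (star (b k)),
      h.star_mul_self, mul_zero, neg_zero, mul_zero]
  simp only [pairFactor, mul_sub, sub_mul, smul_mul_assoc, mul_smul_comm, mul_one, one_mul, h1,
    Pi.neg_apply, Real.sin_neg, Real.cos_neg, ofReal_neg]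
  module

/-- Normal ordering: the terms ending in an annihilator are hidden in `x` and `y`, since they vanish
on the states to which this is applied. -/
lemma IsCAR.star_pairFactor_mul_pairFactor (h : IsCAR b) {k : G} (hk : k ≠ -k) :
    ∃ x y : 𝒜, star (pairFactor θ b k) * pairFactor θ b k =
      1 - (I * Real.cos (θ k) * Real.sin (θ k)) • (star (b k) * star (b (-k))) +
        x * b k + y * b (-k) := by
  have e1 := h.anticomm_star k k
  have e2 := h.anticomm_star k (-k)
  have e3 := h.anticomm_star (-k) (-k)
  have e4 := h.anticomm_star (-k) k
  rw [if_pos rfl] at e1 e3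
  rw [if_neg hk] at e2
  rw [if_neg hk.symm] at e4
  have h1 : b (-k) * b k * (star (b k) * star (b (-k))) =
      1 + (b (-k) * star (b k) * star (b (-k))) * b k + (-star (b (-k))) * b (-k) := by
    calc b (-k) * b k * (star (b k) * star (b (-k)))
        = b (-k) * (b k * star (b k)) * star (b (-k)) := by noncomm_ring
      _ = b (-k) * star (b (-k)) - b (-k) * star (b k) * (b k * star (b (-k))) := by
          rw [eq_sub_of_add_eq e1]; noncomm_ring
      _ = _ := by
          rw [eq_neg_of_add_eq_zero_left e2]
          nth_rw 1 [eq_sub_of_add_eq e3]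
          noncomm_ring
  have h2 : (Real.cos (θ k) : ℂ) * Real.cos (θ k) - I * Real.sin (θ k) * (I * Real.sin (θ k))
      = 1 := by
    have := congrArg ((↑) : ℝ → ℂ) (Real.cos_sq_add_sin_sq (θ k))
    push_cast at this ⊢
    linear_combination this - (sin (θ k)) ^ 2 * I_sq
  refine ⟨(-(I * Real.sin (θ k) * (I * Real.sin (θ k)))) •
      (b (-k) * star (b k) * star (b (-k))) +
      (I * Real.sin (θ k) * Real.cos (θ k)) • b (-k),
    (-(I * Real.sin (θ k) * (I * Real.sin (θ k)))) • (-star (b (-k))), ?_⟩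
  have h3 : star (pairFactor θ b k) =
      (Real.cos (θ k) : ℂ) • 1 + (I * (Real.sin (θ k) : ℂ)) • (b (-k) * b k) := by
    simp [pairFactor, -ofReal_cos, -ofReal_sin]
  rw [h3]
  simp only [pairFactor, mul_sub, add_mul, smul_mul_assoc, mul_smul_comm, mul_one, one_mul, h1]
  conv_rhs => rw [← one_smul ℂ (1 : 𝒜), ← h2]
  simp only [smul_add, smul_neg, smul_smul, neg_mul]
  module

-- Each of the two linear combinations is an eigenvector of the rotation with factor `e^{iθ_k}`, so
-- their product picks up `e^{2iθ_k}`. This is the phase that the angle is chosen to remove from the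
-- Hamiltonian.
omit [DecidableEq G] in
lemma bogoliubov_quadratic (hθ : ∀ k, θ (-k) = -θ k) (k : G) :
    (star (bogoliubovTransform θ b k) - bogoliubovTransform θ b (-k)) *
      (star (bogoliubovTransform θ b (-k)) + bogoliubovTransform θ b k) =
    exp (2 * I * θ k) • ((star (b k) - b (-k)) * (star (b (-k)) + b k)) := by
  have he : exp (I * θ k) = Real.cos (θ k) + I * Real.sin (θ k) := by
    rw [mul_comm, exp_mul_I]; push_cast; ring
  have h1 : star (bogoliubovTransform θ b k) - bogoliubovTransform θ b (-k) =
      exp (I * θ k) • (star (b k) - b (-k)) := by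
    rw [star_bogoliubovTransform, bogoliubovTransform, hθ, neg_neg, Real.cos_neg, Real.sin_neg, he,
      ofReal_neg]
    module
  have h2 : star (bogoliubovTransform θ b (-k)) + bogoliubovTransform θ b k =
      exp (I * θ k) • (star (b (-k)) + b k) := by
    rw [star_bogoliubovTransform, bogoliubovTransform, hθ, neg_neg, Real.cos_neg, Real.sin_neg, he,
      ofReal_neg]
    module
  rw [h1, h2, smul_mul_smul_comm, ← exp_add]
  ring_nf

omit [StarModule ℂ 𝒜] in
lemma IsCAR.sum_quadratic [Fintype G] {a : G → 𝒜} (h : IsCAR a) {ω : G → ℂ}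
    (hω : ∀ k, ω (-k) = ω k) :
    ∑ k, ω k • ((star (a k) - a (-k)) * (star (a (-k)) + a k)) =
      ∑ k, ω k • ((2 : ℂ) • (star (a k) * a k) - 1) := by
  have h0 : ∀ f : G → 𝒜, (∀ k, f (-k) = -f k) → ∑ k, f k = 0 := by
    intro f hf
    have h1 : ∑ k, f k = -∑ k, f k := by
      rw [← Finset.sum_neg_distrib, ← Equiv.sum_comp (Equiv.neg G)]
      simp [hf]
    have h2 : (2 : ℂ) • ∑ k, f k = 0 := by
      rw [two_smul]; nth_rw 1 [h1]; simp
    simpa using h2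
  have h1 : ∑ k, ω k • (star (a k) * star (a (-k)) - a (-k) * a k) = 0 := by
    refine h0 _ fun k => ?_
    rw [hω, neg_neg, eq_neg_of_add_eq_zero_left (h.star_anticomm (-k) k),
      eq_neg_of_add_eq_zero_left (h.anticomm k (-k))]
    module
  have h2 : ∑ k, ω k • (star (a (-k)) * a (-k)) = ∑ k, ω k • (star (a k) * a k) := by
    rw [← Equiv.sum_comp (Equiv.neg G)]
    simp [hω]
  have h3 : ∀ k, ω k • ((star (a k) - a (-k)) * (star (a (-k)) + a k)) =
      ω k • (star (a k) * star (a (-k)) - a (-k) * a k) + ω k • (star (a (-k)) * a (-k)) +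
        (ω k • (star (a k) * a k) - ω k • 1) := by
    intro k
    have e := h.anticomm_star (-k) (-k)
    rw [if_pos rfl] at e
    rw [mul_add, sub_mul, sub_mul, eq_sub_of_add_eq e]
    module
  simp only [h3, Finset.sum_add_distrib, h1, h2, zero_add, Finset.sum_sub_distrib]
  simp only [smul_sub, Finset.sum_sub_distrib, two_smul, smul_add, Finset.sum_add_distrib]
  abel

omit [Algebra ℂ 𝒜] [StarModule ℂ 𝒜] in
lemma IsCAR.number_mul {ι : Type*} [DecidableEq ι] {a : ι → 𝒜} (h : IsCAR a) (l k : ι) :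
    star (a l) * a l * a k = a k * (star (a l) * a l) - if k = l then a k else 0 := by
  have e := h.anticomm_star k l
  rw [mul_assoc, eq_neg_of_add_eq_zero_left (h.anticomm l k), ← mul_assoc (a k),
    eq_sub_of_add_eq e]
  split_ifs with hkl
  · subst hkl; noncomm_ring
  · noncomm_ring

-- Ladder relation: `a_k` lowers the energy by `2 ω_k`.
omit [StarModule ℂ 𝒜] in
lemma IsCAR.sum_number_mul {ι : Type*} [DecidableEq ι] [Fintype ι] {a : ι → 𝒜} (h : IsCAR a)
    (ω : ι → ℂ) (k : ι) :
    (∑ l, ω l • ((2 : ℂ) • (star (a l) * a l) - 1)) * a k =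
      a k * ∑ l, ω l • ((2 : ℂ) • (star (a l) * a l) - 1) - (2 * ω k) • a k := by
  have h1 : ∀ l, ω l • ((2 : ℂ) • (star (a l) * a l) - 1) * a k =
      a k * (ω l • ((2 : ℂ) • (star (a l) * a l) - 1)) - if k = l then (2 * ω l) • a k else 0 := by
    intro l
    rw [smul_mul_assoc, sub_mul, smul_mul_assoc, h.number_mul, mul_smul_comm, mul_sub,
      mul_smul_comm, one_mul, mul_one]
    split_ifs <;> module
  rw [Finset.sum_mul, Finset.mul_sum, Finset.sum_congr rfl fun l _ => h1 l,
    Finset.sum_sub_distrib]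
  simp

end Fermions

end

section

open Complex

/-! ### The dispersion relation and the Bogoliubov angle. -/

section Angles

lemma norm_dispersion_neg (φ q : ℝ) :
    ‖(Real.sin φ : ℂ) + (Real.cos φ : ℂ) * exp (I * (2 * (-q) : ℝ))‖ =
      ‖(Real.sin φ : ℂ) + (Real.cos φ : ℂ) * exp (I * (2 * q : ℝ))‖ := by
  rw [← Complex.norm_conj]
  congr 1
  simp only [map_add, map_mul, conj_ofReal, ← exp_conj, conj_I]
  push_cast
  ring_nf

lemma bogoliubovAngle_neg (φ q : ℝ) : bogoliubovAngle φ (-q) = -bogoliubovAngle φ q := by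
  unfold bogoliubovAngle
  rw [norm_dispersion_neg]
  simp only [Real.sin_neg, Real.cos_neg, neg_eq_zero]
  split_ifs
  · simp
  · rw [← Real.arctan_neg, mul_neg, div_neg]

lemma exp_two_mul_add_int (q : ℝ) (n : ℤ) :
    exp (I * (2 * (q + n * (2 * Real.pi)) : ℝ)) = exp (I * (2 * q : ℝ)) := by
  have : I * ((2 * (q + n * (2 * Real.pi)) : ℝ) : ℂ) =
      I * (2 * q : ℝ) + (2 * n : ℤ) * (2 * Real.pi * I) := by
    push_cast; ring
  rw [this, exp_periodic.int_mul _ _]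

lemma bogoliubovAngle_add_int (φ q : ℝ) (n : ℤ) :
    bogoliubovAngle φ (q + n * (2 * Real.pi)) = bogoliubovAngle φ q := by
  unfold bogoliubovAngle
  rw [exp_two_mul_add_int, Real.sin_add_int_mul_two_pi, Real.cos_add_int_mul_two_pi]

lemma cos_bogoliubovAngle_pos (φ q : ℝ) : 0 < Real.cos (bogoliubovAngle φ q) := by
  unfold bogoliubovAngle
  split_ifs
  · simp
  · exact Real.cos_arctan_pos _

lemma dispersion_sq (φ q : ℝ) :
    ‖(Real.sin φ : ℂ) + (Real.cos φ : ℂ) * exp (I * (2 * q : ℝ))‖ ^ 2 =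
      ((Real.cos φ + Real.sin φ) * Real.cos q) ^ 2 +
        ((Real.cos φ - Real.sin φ) * Real.sin q) ^ 2 := by
  have h : (Real.sin φ : ℂ) + (Real.cos φ : ℂ) * exp (I * (2 * q : ℝ)) =
      ((Real.sin φ + Real.cos φ * Real.cos (2 * q) : ℝ) : ℂ) +
        ((Real.cos φ * Real.sin (2 * q) : ℝ) : ℂ) * I := by
    rw [mul_comm I, exp_mul_I]; push_cast; ring
  rw [h, ← normSq_eq_norm_sq, normSq_add_mul_I, Real.cos_two_mul, Real.sin_two_mul]
  have := Real.sin_sq_add_cos_sq q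
  have e : Real.sin q ^ 2 = 1 - Real.cos q ^ 2 := by linarith
  ring_nf
  rw [e]
  ring

lemma dispersion_sq' (φ q : ℝ) :
    ‖(Real.sin φ : ℂ) + (Real.cos φ : ℂ) * exp (I * (2 * q : ℝ))‖ ^ 2 =
      1 + Real.sin (2 * φ) * Real.cos (2 * q) := by
  rw [dispersion_sq, Real.cos_two_mul, Real.sin_two_mul]
  have e : Real.sin q ^ 2 = 1 - Real.cos q ^ 2 := by linarith [Real.sin_sq_add_cos_sq q]
  have e' : Real.sin φ ^ 2 = 1 - Real.cos φ ^ 2 := by linarith [Real.sin_sq_add_cos_sq φ]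
  ring_nf
  rw [e, e']
  ring

/-- Write the right side as `C + iD`, of modulus `w`. The definition of the angle is the half-angle
formula `tan θ = (w - C) / D`. -/
lemma dispersion_eq {φ : ℝ} (hφ : φ ∈ Set.Ioo 0 (Real.pi / 4)) {q : ℝ}
    (hq : Real.sin q = 0 → Real.cos q = 1) :
    (‖(Real.sin φ : ℂ) + (Real.cos φ : ℂ) * exp (I * (2 * q : ℝ))‖ : ℂ) *
        exp (2 * I * bogoliubovAngle φ q) =
      Real.cos φ * exp (I * q) + Real.sin φ * exp (-(I * q)) := by
  have hlt : Real.sin φ < Real.cos φ := by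
    rw [← Real.cos_pi_div_two_sub]
    exact Real.cos_lt_cos_of_nonneg_of_le_pi_div_two (by linarith [hφ.1])
      (by linarith [hφ.1]) (by linarith [hφ.2])
  have hs : 0 < Real.sin φ := Real.sin_pos_of_pos_of_lt_pi hφ.1 (by linarith [hφ.2, Real.pi_pos])
  have hsq := dispersion_sq φ q
  have hrhs : (Real.cos φ : ℂ) * exp (I * q) + Real.sin φ * exp (-(I * q)) =
      (((Real.cos φ + Real.sin φ) * Real.cos q : ℝ) : ℂ) +
        (((Real.cos φ - Real.sin φ) * Real.sin q : ℝ) : ℂ) * I := by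
    rw [mul_comm I, ← neg_mul, exp_mul_I, exp_mul_I]; push_cast; rw [cos_neg, sin_neg]; ring
  rw [hrhs]
  unfold bogoliubovAngle
  set w := ‖(Real.sin φ : ℂ) + (Real.cos φ : ℂ) * exp (I * (2 * q : ℝ))‖ with hw
  have hw0 : 0 ≤ w := norm_nonneg _
  split_ifs with h0
  -- Here `D = 0`, and the default angle `0` is right because `cos q = 1` makes `C` positive; at `q
  -- = π` it would fail.
  · rw [h0, hq h0] at hsq ⊢
    have : w = Real.cos φ + Real.sin φ := by
      rw [← abs_of_nonneg hw0, ← abs_of_pos (show 0 < Real.cos φ + Real.sin φ by linarith)]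
      rw [← sq_eq_sq_iff_abs_eq_abs, hsq]; ring
    rw [this]
    simp
  · set C := (Real.cos φ + Real.sin φ) * Real.cos q with hC
    have hC' : (Real.sin φ + Real.cos φ) * Real.cos q = C := by rw [hC]; ring
    rw [hC']
    set D := (Real.cos φ - Real.sin φ) * Real.sin q with hD
    have hD0 : D ≠ 0 := mul_ne_zero (by linarith) h0
    have hD2 : 0 < D ^ 2 := by positivity
    have hCw : C < w := lt_of_pow_lt_pow_left₀ 2 hw0 (by rw [hsq]; linarith)
    have hwpos : 0 < w := by
      rcases hw0.eq_or_lt with h | h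
      · rw [← h] at hsq; nlinarith
      · exact h
    set t := (w - C) / D with ht
    -- From `w² = C² + D²` one gets `D² + (w - C)² = 2w(w - C)`.
    have h1 : 1 + t ^ 2 = 2 * w * (w - C) / D ^ 2 := by
      rw [ht]; field_simp; linarith
    have hc2 : Real.cos (Real.arctan t) ^ 2 = D ^ 2 / (2 * w * (w - C)) := by
      rw [Real.cos_sq_arctan, h1, one_div_div]
    have hwC : w - C ≠ 0 := by linarith
    have hcos : w * Real.cos (2 * Real.arctan t) = C := by
      rw [Real.cos_two_mul, hc2]
      field_simp
      linarith
    have hsin : w * Real.sin (2 * Real.arctan t) = D := by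
      have : Real.sin (Real.arctan t) = t * Real.cos (Real.arctan t) := by
        conv_lhs => rw [← Real.tan_mul_cos (Real.cos_arctan_pos t).ne', Real.tan_arctan]
      rw [Real.sin_two_mul, this]
      have : w * (2 * (t * Real.cos (Real.arctan t)) * Real.cos (Real.arctan t)) =
        2 * w * t * Real.cos (Real.arctan t) ^ 2 := by ring
      rw [this, hc2, ht]
      field_simp
    rw [← hcos, ← hsin, show 2 * I * (Real.arctan t : ℂ) = ((2 * Real.arctan t : ℝ) : ℂ) * I by
      push_cast; ring, exp_mul_I]
    push_cast
    ring

end Angles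

/-! ### Fourier modes indexed by `ZMod N` and the diagonal form of the Hamiltonian. -/

section Momenta

variable {N : ℕ} [NeZero N]

/-- The class modulo `N` of the number of a lattice site. -/
def siteClass (j : Fin N) : ZMod N := (((j : ℕ) + 1 : ℕ) : ZMod N)

omit [NeZero N] in
lemma siteClass_injective : Function.Injective (siteClass : Fin N → ZMod N) := by
  intro i j h
  simp only [siteClass, Nat.cast_add, Nat.cast_one, add_left_inj] at h
  rw [ZMod.natCast_eq_natCast_iff', Nat.mod_eq_of_lt i.2, Nat.mod_eq_of_lt j.2] at h
  exact Fin.ext h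

omit [NeZero N] in
lemma siteClass_finRotate (j : Fin N) : siteClass (finRotate N j) = siteClass j + 1 := by
  simp only [siteClass, finRotate_val]
  split_ifs with h
  · simp [h]
  · push_cast; rfl

lemma siteClass_bijective : Function.Bijective (siteClass : Fin N → ZMod N) := by
  rw [Fintype.bijective_iff_injective_and_card]
  exact ⟨siteClass_injective, by simp [ZMod.card]⟩

omit [NeZero N] in
lemma siteClass_rev (j : Fin N) : siteClass j.rev = 1 - siteClass j := by
  simp only [siteClass, Fin.val_rev]
  have h : (((N - (j + 1) : ℕ) + (j + 1) : ℕ) : ZMod N) = 0 := by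
    rw [Nat.sub_add_cancel j.2, ZMod.natCast_self]
  push_cast at h ⊢
  linear_combination h

/-- The Fourier coefficients `N^{-1/2} e^{-iqj}`. -/
def fourierCoeff (k : ZMod N) (j : Fin N) : ℂ :=
  1 / (Real.sqrt N : ℂ) * ZMod.stdAddChar (-(k * siteClass j))

omit [NeZero N] in
lemma sqrt_mul_sqrt_natCast : (1 / (Real.sqrt N : ℂ)) * (1 / (Real.sqrt N : ℂ)) = (N : ℂ)⁻¹ := by
  rw [div_mul_div_comm, one_mul, ← ofReal_mul, Real.mul_self_sqrt (Nat.cast_nonneg N)]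
  simp

lemma star_fourierCoeff (k : ZMod N) (j : Fin N) :
    star (fourierCoeff k j) = fourierCoeff (-k) j := by
  simp only [fourierCoeff, star_mul', star_div₀, star_one]
  rw [neg_mul, neg_neg, Complex.star_def, conj_ofReal,
    ← AddChar.map_neg_eq_conj, neg_neg]

lemma fourierCoeff_orthogonal (k l : ZMod N) :
    ∑ j, fourierCoeff k j * star (fourierCoeff l j) = if k = l then 1 else 0 := by
  have h1 : ∀ j : Fin N, fourierCoeff k j * star (fourierCoeff l j) =
      (N : ℂ)⁻¹ * ZMod.stdAddChar (siteClass j * (l - k)) := by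
    intro j
    rw [star_fourierCoeff, fourierCoeff, fourierCoeff, mul_mul_mul_comm, sqrt_mul_sqrt_natCast,
      ← AddChar.map_add_eq_mul]
    congr 2; ring
  simp only [h1, ← Finset.mul_sum]
  rw [siteClass_bijective.sum_comp (fun x : ZMod N => (ZMod.stdAddChar (x * (l - k)) : ℂ)),
    AddChar.sum_mulShift _ (ZMod.isPrimitive_stdAddChar N), ZMod.card]
  simp only [sub_eq_zero, eq_comm (a := l)]
  have : (N : ℂ) ≠ 0 := Nat.cast_ne_zero.2 (NeZero.ne N)
  split_ifs <;> simp [this]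

lemma exp_eq_stdAddChar (m : ℤ) (j : Fin N) :
    exp (-I * ((2 * Real.pi * m / N : ℝ) : ℂ) * (((j : ℕ) + 1 : ℕ) : ℂ)) =
      ZMod.stdAddChar (-((m : ZMod N) * siteClass j)) := by
  have : -((m : ZMod N) * siteClass j) = ((-(m * ((j : ℕ) + 1 : ℕ)) : ℤ) : ZMod N) := by
    simp [siteClass]
  rw [this, ZMod.stdAddChar_coe]
  congr 1
  push_cast
  ring

/-- The Fourier transformed fermions, indexed by `ZMod N`. -/
def mode (k : ZMod N) : Op N := ∑ j, fourierCoeff k j • jordanWigner j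

/-- The Bogoliubov angles, indexed by `ZMod N`. -/
def modeAngle (N : ℕ) [NeZero N] (φ : ℝ) (k : ZMod N) : ℝ :=
  bogoliubovAngle φ (2 * Real.pi * (k.val : ℤ) / N)

/-- The Bogoliubov fermions, indexed by `ZMod N`. -/
def quasiMode (φ : ℝ) (k : ZMod N) : Op N := bogoliubovTransform (modeAngle N φ) mode k

/-- The one-particle energies, indexed by `ZMod N`. -/
def modeEnergy (N : ℕ) [NeZero N] (φ : ℝ) (k : ZMod N) : ℝ :=
  ‖(Real.sin φ : ℂ) + (Real.cos φ : ℂ) * exp (I * (2 * (2 * Real.pi * (k.val : ℤ) / N) : ℝ))‖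

/-- Quantities on `ZMod N` are defined through the representative `val`; with periodicity in `q` any
integer representative, negative ones included, may be used. -/
lemma exists_momentum_eq (m : ℤ) : ∃ n : ℤ,
    2 * Real.pi * m / N = 2 * Real.pi * ((m : ZMod N).val : ℤ) / N + n * (2 * Real.pi) := by
  have h : (((m : ZMod N).val : ℤ) : ZMod N) = (m : ZMod N) := by simp
  rw [ZMod.intCast_eq_intCast_iff_dvd_sub] at h
  obtain ⟨n, hn⟩ := h
  refine ⟨n, ?_⟩
  have hN : (N : ℝ) ≠ 0 := Nat.cast_ne_zero.2 (NeZero.ne N)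
  have hn' : (m : ℝ) = ((m : ZMod N).val : ℤ) + N * n := by
    have := congrArg (Int.cast : ℤ → ℝ) (eq_add_of_sub_eq' hn)
    push_cast at this ⊢
    linarith
  rw [hn']
  push_cast
  field_simp

lemma bogoliubovAngle_momentum (φ : ℝ) (m : ℤ) :
    bogoliubovAngle φ (2 * Real.pi * m / N) = modeAngle N φ m := by
  obtain ⟨n, hn⟩ := exists_momentum_eq (N := N) m
  rw [hn, bogoliubovAngle_add_int, modeAngle]

lemma norm_dispersion_momentum (φ : ℝ) (m : ℤ) :
    ‖(Real.sin φ : ℂ) + (Real.cos φ : ℂ) * exp (I * (2 * (2 * Real.pi * m / N) : ℝ))‖ =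
      modeEnergy N φ m := by
  obtain ⟨n, hn⟩ := exists_momentum_eq (N := N) m
  rw [hn, exp_two_mul_add_int, modeEnergy]

lemma modeAngle_neg (φ : ℝ) (k : ZMod N) : modeAngle N φ (-k) = -modeAngle N φ k := by
  obtain ⟨m, rfl⟩ := ZMod.intCast_surjective k
  rw [← Int.cast_neg, ← bogoliubovAngle_momentum, ← bogoliubovAngle_momentum,
    ← bogoliubovAngle_neg]
  push_cast; ring_nf

lemma modeEnergy_neg (φ : ℝ) (k : ZMod N) : modeEnergy N φ (-k) = modeEnergy N φ k := by
  obtain ⟨m, rfl⟩ := ZMod.intCast_surjective k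
  rw [← Int.cast_neg, ← norm_dispersion_momentum, ← norm_dispersion_momentum,
    ← norm_dispersion_neg]
  push_cast; ring_nf

lemma fourierMode_momentum (m : ℤ) : fourierMode N (2 * Real.pi * m / N) = mode (m : ZMod N) := by
  rw [fourierMode, mode, Finset.smul_sum]
  refine Finset.sum_congr rfl fun j _ => ?_
  rw [exp_eq_stdAddChar, smul_smul, fourierCoeff]

lemma bogoliubov_momentum (φ : ℝ) (m : ℤ) :
    bogoliubov N φ (2 * Real.pi * m / N) = quasiMode φ (m : ZMod N) := by
  have h : -(2 * Real.pi * (m : ℝ) / N) = 2 * Real.pi * (-m : ℤ) / N := by push_cast; ring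
  rw [bogoliubov, h, fourierMode_momentum, fourierMode_momentum, bogoliubovAngle_momentum,
    quasiMode, bogoliubovTransform, Matrix.star_eq_conjTranspose, Int.cast_neg]

lemma isCAR_mode : IsCAR (mode : ZMod N → Op N) :=
  isCAR_jordanWigner.unitary fourierCoeff fourierCoeff_orthogonal

lemma isCAR_quasiMode (φ : ℝ) : IsCAR (quasiMode φ : ZMod N → Op N) :=
  isCAR_mode.bogoliubov (modeAngle_neg φ)

lemma star_mode_add_mode (k : ZMod N) :
    star (mode (-k)) + mode k = ∑ j, fourierCoeff k j • majoranaA j := by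
  simp only [mode, star_sum, star_smul, star_fourierCoeff, neg_neg, ← Finset.sum_add_distrib,
    ← smul_add, Matrix.star_eq_conjTranspose, majoranaA]

lemma star_mode_sub_mode (k : ZMod N) :
    star (mode k) - mode (-k) = ∑ j, fourierCoeff (-k) j • majoranaD j := by
  simp only [mode, star_sum, star_smul, star_fourierCoeff, ← Finset.sum_sub_distrib,
    ← smul_sub, Matrix.star_eq_conjTranspose, majoranaD]

lemma sum_stdAddChar_mul (x : ZMod N) :
    ∑ k : ZMod N, (ZMod.stdAddChar (k * x) : ℂ) = if x = 0 then (N : ℂ) else 0 := by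
  rw [AddChar.sum_mulShift _ (ZMod.isPrimitive_stdAddChar N), ZMod.card]
  split_ifs <;> simp

/-- Orthogonality of characters turns the two phases in the coefficient into the two
nearest-neighbour hoppings on the ring. -/
lemma fermionHamiltonian_eq_sum_mode (φ : ℝ) :
    fermionHamiltonian N φ = ∑ k : ZMod N,
      ((Real.cos φ : ℂ) * ZMod.stdAddChar k + Real.sin φ * ZMod.stdAddChar (-k)) •
        ((star (mode k) - mode (-k)) * (star (mode (-k)) + mode k)) := by
  have hN : (N : ℂ) ≠ 0 := Nat.cast_ne_zero.2 (NeZero.ne N)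
  have hcoef : ∀ i j : Fin N, ∑ k : ZMod N,
      ((Real.cos φ : ℂ) * ZMod.stdAddChar k + Real.sin φ * ZMod.stdAddChar (-k)) *
        (fourierCoeff (-k) i * fourierCoeff k j) =
      (Real.cos φ : ℂ) * (if j = finRotate N i then 1 else 0) +
        (Real.sin φ : ℂ) * (if i = finRotate N j then 1 else 0) := by
    intro i j
    have h1 : ∀ k : ZMod N,
      ((Real.cos φ : ℂ) * ZMod.stdAddChar k + Real.sin φ * ZMod.stdAddChar (-k)) *
        (fourierCoeff (-k) i * fourierCoeff k j) = (N : ℂ)⁻¹ * (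
          Real.cos φ * ZMod.stdAddChar (k * (siteClass i + 1 - siteClass j)) +
          Real.sin φ * ZMod.stdAddChar (k * (siteClass i - (siteClass j + 1)))) := by
      intro k
      rw [show k * (siteClass i + 1 - siteClass j) =
        k + (-(-k * siteClass i) + -(k * siteClass j)) by ring,
        show k * (siteClass i - (siteClass j + 1)) =
        -k + (-(-k * siteClass i) + -(k * siteClass j)) by ring]
      simp only [AddChar.map_add_eq_mul, fourierCoeff, ← sqrt_mul_sqrt_natCast]
      ring
    have e1 : siteClass i + 1 - siteClass j = 0 ↔ j = finRotate N i := by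
      rw [sub_eq_zero, ← siteClass_finRotate, siteClass_injective.eq_iff, eq_comm]
    have e2 : siteClass i - (siteClass j + 1) = 0 ↔ i = finRotate N j := by
      rw [sub_eq_zero, ← siteClass_finRotate, siteClass_injective.eq_iff]
    simp only [h1, ← Finset.mul_sum, Finset.sum_add_distrib, sum_stdAddChar_mul, e1, e2]
    split_ifs <;> field_simp <;> simp
  have h2 : ∀ k : ZMod N,
      ((Real.cos φ : ℂ) * ZMod.stdAddChar k + Real.sin φ * ZMod.stdAddChar (-k)) •
        ((star (mode k) - mode (-k)) * (star (mode (-k)) + mode k)) =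
      ∑ i, ∑ j, (((Real.cos φ : ℂ) * ZMod.stdAddChar k + Real.sin φ * ZMod.stdAddChar (-k)) *
        (fourierCoeff (-k) i * fourierCoeff k j)) • (majoranaD i * majoranaA j) := by
    intro k
    rw [star_mode_add_mode, star_mode_sub_mode, Finset.sum_mul_sum]
    simp only [Finset.smul_sum, smul_mul_smul_comm, smul_smul]
  simp only [h2]
  rw [Finset.sum_comm]
  simp only [Finset.sum_comm (s := (Finset.univ : Finset (ZMod N))), ← Finset.sum_smul, hcoef]
  simp only [add_smul, Finset.sum_add_distrib, mul_ite, mul_one, mul_zero, ite_smul, zero_smul,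
    Finset.sum_ite_eq', Finset.mem_univ, if_true]
  rw [Finset.sum_comm (f := fun i j => if i = finRotate N j then
    (Real.sin φ : ℂ) • (majoranaD i * majoranaA j) else 0)]
  simp [fermionHamiltonian, Finset.sum_add_distrib]

/-- For odd `N` the momentum `π` is not available, which excludes the bad case of `dispersion_eq`.
-/
lemma sin_momentum_eq_zero (hN : Odd N) (m : ℤ) (h : Real.sin (2 * Real.pi * m / N) = 0) :
    Real.cos (2 * Real.pi * m / N) = 1 := by
  obtain ⟨n, hn⟩ := Real.sin_eq_zero_iff.mp h
  have hN0 : (N : ℝ) ≠ 0 := Nat.cast_ne_zero.2 (NeZero.ne N)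
  have h1 : (n : ℝ) * N = 2 * m := by
    rw [eq_div_iff hN0] at hn
    have := Real.pi_ne_zero
    apply mul_left_cancel₀ this
    linarith
  have h2 : n * (N : ℤ) = 2 * m := by exact_mod_cast h1
  have h3 : Even n := by
    have : Even (n * (N : ℤ)) := by rw [h2]; exact even_two_mul m
    rcases Int.even_mul.mp this with h | h
    · exact h
    · rw [Int.even_coe_nat] at h
      exact absurd h (Nat.not_even_iff_odd.mpr hN)
  obtain ⟨r, hr⟩ := h3
  rw [← hn, hr]
  have : ((r + r : ℤ) : ℝ) * Real.pi = r * (2 * Real.pi) := by push_cast; ring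
  rw [this, Real.cos_int_mul_two_pi]

theorem fermionHamiltonian_eq (hN : Odd N) {φ : ℝ} (hφ : φ ∈ Set.Ioo 0 (Real.pi / 4)) :
    fermionHamiltonian N φ = ∑ k : ZMod N, (modeEnergy N φ k : ℂ) •
      ((2 : ℂ) • (star (quasiMode φ k) * quasiMode φ k) - 1) := by
  rw [← (isCAR_quasiMode φ).sum_quadratic (ω := fun k => (modeEnergy N φ k : ℂ))
    (fun k => by rw [modeEnergy_neg]), fermionHamiltonian_eq_sum_mode]
  refine Finset.sum_congr rfl fun k _ => ?_
  unfold quasiMode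
  rw [bogoliubov_quadratic (modeAngle_neg φ), smul_smul]
  congr 1
  obtain ⟨m, rfl⟩ := ZMod.intCast_surjective k
  rw [← norm_dispersion_momentum, ← bogoliubovAngle_momentum,
    dispersion_eq hφ (sin_momentum_eq_zero hN m), ← Int.cast_neg, ZMod.stdAddChar_coe,
    ZMod.stdAddChar_coe]
  congr 2
  · congr 1; push_cast; ring
  · congr 1; push_cast; ring

end Momenta

end

section

/-! ### The product of pair factors as an intertwiner from `b` to `a`. -/

section PairProduct

variable {𝒜 : Type*} [Ring 𝒜] [StarRing 𝒜] [Algebra ℂ 𝒜] [StarModule ℂ 𝒜]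
  {G : Type*} [AddCommGroup G] [DecidableEq G] {θ : G → ℝ} {b : G → 𝒜}

/-- The ordered product of the factors `cos θ_k - i sin θ_k b_k† b_{-k}†` over a list. -/
def pairProd (θ : G → ℝ) (b : G → 𝒜) (L : List G) : 𝒜 := (L.map (pairFactor θ b)).prod

omit [StarModule ℂ 𝒜] [DecidableEq G] in
lemma pairProd_cons (k : G) (L : List G) :
    pairProd θ b (k :: L) = pairFactor θ b k * pairProd θ b L := by
  simp [pairProd]

omit [StarModule ℂ 𝒜] [DecidableEq G] in
lemma commute_pairProd {x : 𝒜} {L : List G}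
    (h : ∀ k ∈ L, Commute x (star (b k) * star (b (-k)))) : Commute x (pairProd θ b L) := by
  refine Commute.list_prod_right _ _ fun y hy => ?_
  obtain ⟨k, hk, rfl⟩ := List.mem_map.mp hy
  exact commute_pairFactor (h k hk)

omit [StarModule ℂ 𝒜] in
lemma IsCAR.commute_pairProd (h : IsCAR b) {m : G} {L : List G}
    (hm : ∀ k ∈ L, m ≠ k ∧ m ≠ -k) : Commute (b m) (pairProd θ b L) := by
  refine Commute.list_prod_right _ _ fun y hy => ?_
  obtain ⟨k, hk, rfl⟩ := List.mem_map.mp hy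
  exact h.commute_pairFactor (hm k hk).1 (hm k hk).2

omit [StarModule ℂ 𝒜] in
lemma IsCAR.bogoliubovTransform_mul_pairProd (h : IsCAR b) (hθ : ∀ k, θ (-k) = -θ k)
    {L : List G} (hL : L.Pairwise fun x y => x ≠ y ∧ x ≠ -y) (hn : ∀ x ∈ L, x ≠ -x) {m : G}
    (hm : m ∈ L ∨ -m ∈ L) :
    bogoliubovTransform θ b m * pairProd θ b L =
      (Real.cos (θ m) : ℂ) • (pairProd θ b L * b m) := by
  induction L with
  | nil => simp at hm
  | cons x L ih =>
    rw [List.pairwise_cons] at hL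
    rw [pairProd_cons, ← mul_assoc]
    -- Exactly one factor of the product involves the pair `±m`; it converts `a_m` to `b_m`, and all
    -- others commute with both.
    by_cases h1 : m = x
    · subst h1
      rw [h.bogoliubovTransform_mul_pairFactor (hn m List.mem_cons_self), smul_mul_assoc,
        mul_assoc, (h.commute_pairProd hL.1).eq, mul_assoc]
    by_cases h2 : m = -x
    · subst h2
      have h3 : ∀ k ∈ L, -x ≠ k ∧ -x ≠ -k := fun k hk =>
        ⟨fun e => (hL.1 k hk).2 (by rw [← e, neg_neg]), fun e => (hL.1 k hk).1 (neg_injective e)⟩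
      rw [h.bogoliubovTransform_neg_mul_pairFactor hθ (hn x List.mem_cons_self), smul_mul_assoc,
        mul_assoc, (h.commute_pairProd h3).eq, mul_assoc, hθ, Real.cos_neg]
    · have h3 : -m ≠ x := fun e => h2 (by rw [← e, neg_neg])
      have hm' : m ∈ L ∨ -m ∈ L := by simpa [h1, h3] using hm
      rw [(h.bogoliubovTransform_commute_pairFactor h1 h2).eq, mul_assoc,
        ih hL.2 (fun y hy => hn y (List.mem_cons_of_mem _ hy)) hm', mul_smul_comm, mul_assoc]

omit [StarModule ℂ 𝒜] in
lemma IsCAR.isUnit_pairFactor (h : IsCAR b) {k : G} (hk : Real.cos (θ k) ≠ 0) :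
    IsUnit (pairFactor θ b k) := by
  have h0 : (Real.cos (θ k) : ℂ) ^ 2 ≠ 0 := pow_ne_zero _ (Complex.ofReal_ne_zero.mpr hk)
  have h1 := h.pairFactor_mul_pairFactor_neg (θ := θ) k
  have h2 := h.pairFactor_mul_pairFactor_neg (θ := -θ) k
  rw [neg_neg, Pi.neg_apply, Real.cos_neg] at h2
  refine isUnit_iff_exists.mpr ⟨((Real.cos (θ k) : ℂ) ^ 2)⁻¹ • pairFactor (-θ) b k, ?_, ?_⟩
  · rw [mul_smul_comm, h1, smul_smul, inv_mul_cancel₀ h0, one_smul]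
  · rw [smul_mul_assoc, h2, smul_smul, inv_mul_cancel₀ h0, one_smul]

omit [StarModule ℂ 𝒜] in
lemma IsCAR.isUnit_pairProd (h : IsCAR b) (hθ : ∀ k, Real.cos (θ k) ≠ 0) (L : List G) :
    IsUnit (pairProd θ b L) := by
  induction L with
  | nil => simp [pairProd]
  | cons x L ih =>
    rw [pairProd_cons]
    exact (h.isUnit_pairFactor (hθ x)).mul ih

end PairProduct

/-! ### The inner product. -/

section Braket

variable {N : ℕ}

lemma braket_mulVec (u v : State N) (A : Op N) :
    braket u (A *ᵥ v) = braket (Aᴴ *ᵥ u) v := by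
  rw [braket, braket, Matrix.star_mulVec, Matrix.conjTranspose_conjTranspose,
    Matrix.dotProduct_mulVec]

lemma braket_add_right (u v w : State N) : braket u (v + w) = braket u v + braket u w :=
  dotProduct_add _ _ _

lemma braket_add_left (u v w : State N) : braket (u + v) w = braket u w + braket v w := by
  simp [braket, add_dotProduct]

lemma braket_sub_right (u v w : State N) : braket u (v - w) = braket u v - braket u w :=
  dotProduct_sub _ _ _

lemma braket_smul_right (z : ℂ) (u v : State N) : braket u (z • v) = z * braket u v := by
  simp [braket]

lemma braket_smul_left (z : ℂ) (u v : State N) : braket (z • u) v = star z * braket u v := by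
  simp [braket]

lemma braket_neg_left (u v : State N) : braket (-u) v = -braket u v := by
  simp [braket]

lemma braket_zero_left (v : State N) : braket 0 v = 0 := by simp [braket]

lemma star_braket (u v : State N) : star (braket u v) = braket v u := by
  rw [braket, Matrix.star_dotProduct, star_star, braket, dotProduct_comm]

lemma braket_sum_right {ι : Type*} (s : Finset ι) (u : State N) (f : ι → State N) :
    braket u (∑ i ∈ s, f i) = ∑ i ∈ s, braket u (f i) := dotProduct_sum _ _ _

lemma braket_self (v : State N) : braket v v = ((∑ s, Complex.normSq (v s) : ℝ) : ℂ) := by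
  simp [braket, dotProduct, Complex.normSq_eq_conj_mul_self]

lemma braket_self_nonneg (v : State N) : 0 ≤ (braket v v).re := by
  rw [braket_self, Complex.ofReal_re]
  exact Finset.sum_nonneg fun s _ => Complex.normSq_nonneg _

lemma braket_self_pos {v : State N} (hv : v ≠ 0) : 0 < (braket v v).re := by
  rw [braket_self, Complex.ofReal_re]
  obtain ⟨s, hs⟩ := Function.ne_iff.mp hv
  exact Finset.sum_pos' (fun s _ => Complex.normSq_nonneg _)
    ⟨s, Finset.mem_univ s, Complex.normSq_pos.mpr hs⟩

lemma braket_eq_zero_of_parity {Q : Op N} (hQ : Qᴴ = Q) {u v : State N} (hu : Q *ᵥ u = -u)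
    (hv : Q *ᵥ v = v) : braket u v = 0 := by
  have h1 : braket u v = -braket u v := by
    conv_lhs => rw [← hv, braket_mulVec, hQ, hu, braket_neg_left]
  linear_combination h1 / 2

end Braket

/-! ### The Bogoliubov vacuum: annihilation, uniqueness, norm. -/

section Vacuum

variable {N : ℕ} [NeZero N]

/-- The momenta `2πk/N` in `(0, π)`. -/
def positiveMomenta (N : ℕ) : List (ZMod N) :=
  (List.range' 1 ((N - 1) / 2)).map fun k : ℕ => (k : ZMod N)

omit [NeZero N] in
lemma natCast_ne_neg_natCast {k l : ℕ} (hk : 1 ≤ k ∧ k ≤ (N - 1) / 2)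
    (hl : 1 ≤ l ∧ l ≤ (N - 1) / 2) : (k : ZMod N) ≠ -l := by
  intro h
  have h1 : ((k + l : ℕ) : ZMod N) = 0 := by push_cast; rw [h]; ring
  rw [ZMod.natCast_eq_zero_iff] at h1
  have := Nat.le_of_dvd (by omega) h1
  omega

omit [NeZero N] in
lemma mem_positiveMomenta {x : ZMod N} :
    x ∈ positiveMomenta N ↔ ∃ k : ℕ, (1 ≤ k ∧ k ≤ (N - 1) / 2) ∧ (k : ZMod N) = x := by
  simp only [positiveMomenta, List.mem_map, List.mem_range'_1]
  refine exists_congr fun k => and_congr_left fun _ => ?_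
  omega

omit [NeZero N] in
lemma positiveMomenta_ne_neg {x y : ZMod N} (hx : x ∈ positiveMomenta N)
    (hy : y ∈ positiveMomenta N) : x ≠ -y := by
  obtain ⟨k, hk, rfl⟩ := mem_positiveMomenta.mp hx
  obtain ⟨l, hl, rfl⟩ := mem_positiveMomenta.mp hy
  exact natCast_ne_neg_natCast hk hl

omit [NeZero N] in
lemma positiveMomenta_pairwise :
    (positiveMomenta N).Pairwise fun x y => x ≠ y ∧ x ≠ -y := by
  have h1 : (positiveMomenta N).Nodup := by
    refine List.Nodup.map_on ?_ List.nodup_range'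
    intro k hk l hl h
    rw [List.mem_range'_1] at hk hl
    rw [ZMod.natCast_eq_natCast_iff', Nat.mod_eq_of_lt (by omega),
      Nat.mod_eq_of_lt (by omega)] at h
    exact h
  exact h1.imp_of_mem fun hx hy h => ⟨h, positiveMomenta_ne_neg hx hy⟩

lemma mem_or_neg_mem_positiveMomenta (hN : Odd N) {x : ZMod N} (hx : x ≠ 0) :
    x ∈ positiveMomenta N ∨ -x ∈ positiveMomenta N := by
  have hv : x.val ≠ 0 := by rwa [Ne, ZMod.val_eq_zero]
  have hlt := ZMod.val_lt x
  obtain ⟨n, hn⟩ := hN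
  by_cases h : x.val ≤ (N - 1) / 2
  · exact Or.inl (mem_positiveMomenta.mpr ⟨x.val, by omega, by simp⟩)
  · refine Or.inr (mem_positiveMomenta.mpr ⟨N - x.val, by omega, ?_⟩)
    rw [Nat.cast_sub hlt.le]; simp

omit [NeZero N] in
lemma zero_ne_positiveMomenta : ∀ k ∈ positiveMomenta N, (0 : ZMod N) ≠ k ∧ (0 : ZMod N) ≠ -k := by
  intro x hx
  have h0 : (0 : ZMod N) ≠ x := by
    rintro rfl
    exact positiveMomenta_ne_neg hx hx neg_zero.symm
  exact ⟨h0, fun h => h0 (by rw [← neg_neg x, ← h, neg_zero])⟩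

lemma vacuumMinus_eq (φ : ℝ) :
    vacuumMinus N φ = pairProd (modeAngle N φ) mode (positiveMomenta N) *ᵥ allUp N := by
  have h : ∀ k : ℕ, -(2 * Real.pi * (k : ℝ) / N) = 2 * Real.pi * (-(k : ℤ) : ℤ) / N := by
    intro k; push_cast; ring
  have h' : ∀ k : ℕ, 2 * Real.pi * (k : ℝ) / N = 2 * Real.pi * (k : ℤ) / N := by
    intro k; push_cast; ring
  rw [vacuumMinus, pairProd, positiveMomenta, List.map_map]
  congr 3
  ext1 k
  simp only [h, Function.comp]
  simp only [h', fourierMode_momentum, bogoliubovAngle_momentum, pairFactor,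
    Matrix.star_eq_conjTranspose]
  push_cast
  rfl

/-- Used for parity, translation and reflection: each fixes the spin-up state and respects every
pair, so it fixes the vacuum. -/
lemma mulVec_vacuumMinus_of_commute {Q : Op N} (h0 : Q *ᵥ allUp N = allUp N)
    (h : ∀ k : ZMod N, Commute Q (star (mode k) * star (mode (-k)))) (φ : ℝ) :
    Q *ᵥ vacuumMinus N φ = vacuumMinus N φ := by
  rw [vacuumMinus_eq, Matrix.mulVec_mulVec, (commute_pairProd fun k _ => h k).eq,
    ← Matrix.mulVec_mulVec, h0]

lemma modeAngle_zero (φ : ℝ) : modeAngle N φ 0 = 0 := by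
  have := modeAngle_neg (N := N) φ 0
  rw [neg_zero] at this
  linarith

lemma cos_modeAngle_ne_zero (φ : ℝ) (k : ZMod N) : Real.cos (modeAngle N φ k) ≠ 0 :=
  (cos_bogoliubovAngle_pos _ _).ne'

lemma quasiMode_mul_pairProd (hN : Odd N) (φ : ℝ) (m : ZMod N) :
    quasiMode φ m * pairProd (modeAngle N φ) mode (positiveMomenta N) =
      (Real.cos (modeAngle N φ m) : ℂ) •
        (pairProd (modeAngle N φ) mode (positiveMomenta N) * mode m) := by
  by_cases hm : m = 0
  · subst hm
    rw [← (isCAR_mode.commute_pairProd zero_ne_positiveMomenta).eq, quasiMode,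
      bogoliubovTransform, modeAngle_zero]
    simp
  · exact isCAR_mode.bogoliubovTransform_mul_pairProd (modeAngle_neg φ) positiveMomenta_pairwise
      (fun x hx => positiveMomenta_ne_neg hx hx) (mem_or_neg_mem_positiveMomenta hN hm)

lemma mode_mulVec_allUp (k : ZMod N) : mode k *ᵥ allUp N = 0 := by
  simp [mode, Matrix.sum_mulVec, Matrix.smul_mulVec, jordanWigner_mulVec_allUp]

lemma jordanWigner_eq_sum_mode (j : Fin N) :
    jordanWigner j = ∑ k : ZMod N, fourierCoeff (-k) j • mode k := by
  have hN : (N : ℂ) ≠ 0 := Nat.cast_ne_zero.2 (NeZero.ne N)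
  have h1 : ∀ (i : Fin N) (k : ZMod N), fourierCoeff (-k) j * fourierCoeff k i =
      (N : ℂ)⁻¹ * ZMod.stdAddChar (k * (siteClass j - siteClass i)) := by
    intro i k
    rw [fourierCoeff, fourierCoeff, mul_mul_mul_comm, sqrt_mul_sqrt_natCast,
      ← AddChar.map_add_eq_mul]
    congr 2; ring
  simp only [mode, Finset.smul_sum, smul_smul, h1]
  rw [Finset.sum_comm]
  simp only [← Finset.sum_smul, ← Finset.mul_sum, sum_stdAddChar_mul, sub_eq_zero,
    siteClass_injective.eq_iff]
  simp [hN]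

lemma eq_smul_allUp_of_mode_mulVec {v : State N} (h : ∀ k : ZMod N, mode k *ᵥ v = 0) :
    v = v 0 • allUp N := by
  refine eq_smul_allUp_of_jordanWigner_mulVec fun j => ?_
  rw [jordanWigner_eq_sum_mode]
  simp [Matrix.sum_mulVec, Matrix.smul_mulVec, h]

lemma quasiMode_mulVec_vacuumMinus (hN : Odd N) (φ : ℝ) (k : ZMod N) :
    quasiMode φ k *ᵥ vacuumMinus N φ = 0 := by
  rw [vacuumMinus_eq, Matrix.mulVec_mulVec, quasiMode_mul_pairProd hN, Matrix.smul_mulVec,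
    ← Matrix.mulVec_mulVec, mode_mulVec_allUp, Matrix.mulVec_zero, smul_zero]

/-- The intertwiner `U` is invertible because `cos θ_k > 0`, so uniqueness transfers from the bare
vacuum: `U⁻¹ w` is killed by all `b_k`. -/
lemma eq_smul_vacuumMinus (hN : Odd N) {φ : ℝ} {w : State N}
    (h : ∀ k : ZMod N, quasiMode φ k *ᵥ w = 0) : ∃ z : ℂ, w = z • vacuumMinus N φ := by
  set U := pairProd (modeAngle N φ) mode (positiveMomenta N) with hU
  obtain ⟨V, hV1, hV2⟩ := isUnit_iff_exists.mp
    (isCAR_mode.isUnit_pairProd (cos_modeAngle_ne_zero φ) (positiveMomenta N))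
  rw [← hU] at hV1 hV2
  have hw : w = U *ᵥ (V *ᵥ w) := by rw [Matrix.mulVec_mulVec, hV1, Matrix.one_mulVec]
  have h0 : ∀ k : ZMod N, mode k *ᵥ (V *ᵥ w) = 0 := by
    intro k
    have h1 := h k
    rw [hw, Matrix.mulVec_mulVec, quasiMode_mul_pairProd hN, ← hU, Matrix.smul_mulVec,
      smul_eq_zero] at h1
    have h2 := h1.resolve_left (Complex.ofReal_ne_zero.mpr (cos_modeAngle_ne_zero φ k))
    have h3 := congrArg (V *ᵥ ·) h2
    simpa only [Matrix.mulVec_mulVec, ← mul_assoc, hV2, one_mul, Matrix.mulVec_zero] using h3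
  refine ⟨(V *ᵥ w) 0, ?_⟩
  rw [vacuumMinus_eq, ← hU, ← Matrix.mulVec_smul, ← eq_smul_allUp_of_mode_mulVec h0, ← hw]

omit [NeZero N] in
lemma braket_pairFactor_mulVec {b : ZMod N → Op N} (hb : IsCAR b) (θ : ZMod N → ℝ) {k : ZMod N}
    (hk : k ≠ -k) {v : State N} (h1 : b k *ᵥ v = 0) (h2 : b (-k) *ᵥ v = 0) :
    braket (pairFactor θ b k *ᵥ v) (pairFactor θ b k *ᵥ v) = braket v v := by
  obtain ⟨x, y, h⟩ := hb.star_pairFactor_mul_pairFactor (θ := θ) hk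
  have h3 := braket_mulVec v (pairFactor θ b k *ᵥ v) (star (pairFactor θ b k))
  rw [← Matrix.star_eq_conjTranspose, star_star] at h3
  rw [← h3, Matrix.mulVec_mulVec, h]
  simp only [Matrix.add_mulVec, Matrix.sub_mulVec, ← Matrix.mulVec_mulVec, h1, h2,
    Matrix.mulVec_zero, add_zero, Matrix.one_mulVec, Matrix.smul_mulVec, braket_sub_right,
    braket_smul_right]
  -- The remaining pair term vanishes because `b_k†`, moved to the bra, annihilates `v`.
  rw [braket_mulVec, ← Matrix.star_eq_conjTranspose, star_star, h1, braket_zero_left]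
  simp

omit [NeZero N] in
lemma braket_allUp : braket (allUp N) (allUp N) = 1 := by
  have h0 : allUp N = Pi.single 0 1 := rfl
  simp [braket, h0]

omit [NeZero N] in
lemma braket_pairProd_mulVec {b : ZMod N → Op N} (hb : IsCAR b) (θ : ZMod N → ℝ) {v : State N}
    (hv : ∀ k, b k *ᵥ v = 0) {L : List (ZMod N)}
    (hL : L.Pairwise fun x y => x ≠ y ∧ x ≠ -y) (hn : ∀ x ∈ L, x ≠ -x) :
    braket (pairProd θ b L *ᵥ v) (pairProd θ b L *ᵥ v) = braket v v := by
  induction L with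
  | nil => simp [pairProd]
  | cons x L ih =>
    rw [List.pairwise_cons] at hL
    have h3 : ∀ k ∈ L, -x ≠ k ∧ -x ≠ -k := fun k hk =>
      ⟨fun e => (hL.1 k hk).2 (by rw [← e, neg_neg]), fun e => (hL.1 k hk).1 (neg_injective e)⟩
    rw [pairProd_cons, ← Matrix.mulVec_mulVec, braket_pairFactor_mulVec hb θ
      (hn x List.mem_cons_self), ih hL.2 fun y hy => hn y (List.mem_cons_of_mem _ hy)]
    · rw [Matrix.mulVec_mulVec, (hb.commute_pairProd hL.1).eq, ← Matrix.mulVec_mulVec, hv,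
        Matrix.mulVec_zero]
    · rw [Matrix.mulVec_mulVec, (hb.commute_pairProd h3).eq, ← Matrix.mulVec_mulVec, hv,
        Matrix.mulVec_zero]

lemma braket_vacuumMinus (φ : ℝ) : braket (vacuumMinus N φ) (vacuumMinus N φ) = 1 := by
  rw [vacuumMinus_eq, braket_pairProd_mulVec isCAR_mode _ mode_mulVec_allUp
    positiveMomenta_pairwise fun x hx => positiveMomenta_ne_neg hx hx, braket_allUp]

end Vacuum

end

section

open Complex

variable {N : ℕ} [NeZero N]

/-! ### One-particle states. -/

section Particle

/-- The one-particle states `a_k† |0⁻⟩`, indexed by `ZMod N`. -/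
def particle (φ : ℝ) (k : ZMod N) : State N := star (quasiMode φ k) *ᵥ vacuumMinus N φ

lemma oneParticle_momentum (φ : ℝ) (m : ℤ) :
    oneParticle N φ (2 * Real.pi * m / N) = particle φ (m : ZMod N) := by
  rw [oneParticle, bogoliubov_momentum, particle, Matrix.star_eq_conjTranspose]

lemma parityZ_mul_mode (k : ZMod N) : parityZ N * mode k = -(mode k * parityZ N) := by
  simp only [mode, Finset.mul_sum, Finset.sum_mul, mul_smul_comm, smul_mul_assoc,
    parityZ_mul_jordanWigner, smul_neg, Finset.sum_neg_distrib]

lemma parityZ_mul_star_mode (k : ZMod N) :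
    parityZ N * star (mode k) = -(star (mode k) * parityZ N) := by
  have h := congrArg star (parityZ_mul_mode k)
  rw [star_neg, star_mul, star_mul, Matrix.star_eq_conjTranspose (parityZ N),
    parityZ_conjTranspose] at h
  rw [h, neg_neg]

lemma parityZ_mul_star_quasiMode (φ : ℝ) (k : ZMod N) :
    parityZ N * star (quasiMode φ k) = -(star (quasiMode φ k) * parityZ N) := by
  rw [quasiMode, star_bogoliubovTransform, mul_sub, sub_mul, mul_smul_comm, mul_smul_comm,
    parityZ_mul_mode, parityZ_mul_star_mode, smul_mul_assoc, smul_mul_assoc]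
  module

lemma parityZ_mulVec_vacuumMinus (φ : ℝ) :
    parityZ N *ᵥ vacuumMinus N φ = vacuumMinus N φ := by
  refine mulVec_vacuumMinus_of_commute parityZ_mulVec_allUp (fun k => ?_) φ
  rw [commute_iff_eq, ← mul_assoc, parityZ_mul_star_mode, neg_mul, mul_assoc,
    parityZ_mul_star_mode, mul_neg, neg_neg, mul_assoc]

lemma parityZ_mulVec_particle (φ : ℝ) (k : ZMod N) :
    parityZ N *ᵥ particle φ k = -particle φ k := by
  rw [particle, Matrix.mulVec_mulVec, parityZ_mul_star_quasiMode, Matrix.neg_mulVec,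
    ← Matrix.mulVec_mulVec, parityZ_mulVec_vacuumMinus]

lemma quasiMode_mulVec_particle (hN : Odd N) (φ : ℝ) (l k : ZMod N) :
    quasiMode φ l *ᵥ particle φ k = if l = k then vacuumMinus N φ else 0 := by
  rw [particle, Matrix.mulVec_mulVec, eq_sub_of_add_eq ((isCAR_quasiMode φ).anticomm_star l k),
    Matrix.sub_mulVec, ← Matrix.mulVec_mulVec, quasiMode_mulVec_vacuumMinus hN,
    Matrix.mulVec_zero, sub_zero]
  split_ifs <;> simp

lemma braket_particle (hN : Odd N) (φ : ℝ) (k : ZMod N) :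
    braket (particle φ k) (particle φ k) = 1 := by
  conv_lhs => enter [2]; rw [particle]
  rw [braket_mulVec, ← Matrix.star_eq_conjTranspose, star_star, quasiMode_mulVec_particle hN,
    if_pos rfl, braket_vacuumMinus]

end Particle

/-! ### Lower bound on the spectrum and the momentum of least energy. -/

section GroundState

lemma hamiltonian_mulVec_particle (hN : Odd N) {φ : ℝ} (hφ : φ ∈ Set.Ioo 0 (Real.pi / 4))
    (k : ZMod N) : hamiltonian N φ *ᵥ particle φ k =
      ((2 * modeEnergy N φ k - ∑ l, modeEnergy N φ l : ℝ) : ℂ) • particle φ k := by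
  rw [hamiltonian_mulVec_of_odd (parityZ_mulVec_particle φ k), fermionHamiltonian_eq hN hφ]
  have h : ∀ l : ZMod N, ((modeEnergy N φ l : ℂ) •
      ((2 : ℂ) • (star (quasiMode φ l) * quasiMode φ l) - 1)) *ᵥ particle φ k =
      (if l = k then (2 * modeEnergy N φ l : ℂ) • particle φ k else 0) -
        (modeEnergy N φ l : ℂ) • particle φ k := by
    intro l
    rw [Matrix.smul_mulVec, Matrix.sub_mulVec, Matrix.smul_mulVec, ← Matrix.mulVec_mulVec,
      quasiMode_mulVec_particle hN, Matrix.one_mulVec]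
    split_ifs with hl
    · subst hl
      rw [← particle]; module
    · simp
  rw [Matrix.sum_mulVec, Finset.sum_congr rfl fun l _ => h l, Finset.sum_sub_distrib,
    Finset.sum_ite_eq', if_pos (Finset.mem_univ k), ← Finset.sum_smul, ← sub_smul]
  push_cast
  rfl

/-- The number operators have nonnegative expectation. The bound concerns the fermionic Hamiltonian
on the whole space, since it is applied to `a_k w`, which leaves the odd sector. -/
lemma neg_sum_modeEnergy_le (hN : Odd N) {φ : ℝ} (hφ : φ ∈ Set.Ioo 0 (Real.pi / 4)) {E : ℝ}
    {u : State N} (hu : u ≠ 0) (h : fermionHamiltonian N φ *ᵥ u = (E : ℂ) • u) :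
    -∑ k, modeEnergy N φ k ≤ E := by
  have h1 : braket u (fermionHamiltonian N φ *ᵥ u) = ∑ k : ZMod N, (modeEnergy N φ k : ℂ) *
      (2 * braket (quasiMode φ k *ᵥ u) (quasiMode φ k *ᵥ u) - braket u u) := by
    rw [fermionHamiltonian_eq hN hφ, Matrix.sum_mulVec, braket_sum_right]
    refine Finset.sum_congr rfl fun k _ => ?_
    rw [Matrix.smul_mulVec, Matrix.sub_mulVec, Matrix.smul_mulVec, ← Matrix.mulVec_mulVec,
      Matrix.one_mulVec, braket_smul_right, braket_sub_right, braket_smul_right, braket_mulVec,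
      ← Matrix.star_eq_conjTranspose, star_star]
  rw [h, braket_smul_right] at h1
  have h2 := congrArg re h1
  rw [re_ofReal_mul, re_sum] at h2
  have h3 : ∑ k : ZMod N, modeEnergy N φ k * -(braket u u).re ≤ E * (braket u u).re := by
    rw [h2]
    refine Finset.sum_le_sum fun k _ => ?_
    rw [re_ofReal_mul]
    refine mul_le_mul_of_nonneg_left ?_ (norm_nonneg _)
    have := braket_self_nonneg (quasiMode φ k *ᵥ u)
    rw [sub_re, show (2 : ℂ) = ((2 : ℝ) : ℂ) by norm_num, re_ofReal_mul]
    linarith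
  rw [← Finset.sum_mul, mul_neg, ← neg_mul] at h3
  exact le_of_mul_le_mul_right h3 (braket_self_pos hu)

lemma exists_modeEnergy_le (hN : Odd N) {φ : ℝ} (hφ : φ ∈ Set.Ioo 0 (Real.pi / 4)) {E : ℝ}
    {w : State N} (hw : w ≠ 0) (hodd : parityZ N *ᵥ w = -w)
    (h : hamiltonian N φ *ᵥ w = (E : ℂ) • w) :
    ∃ k : ZMod N, 2 * modeEnergy N φ k - ∑ l, modeEnergy N φ l ≤ E := by
  rw [hamiltonian_mulVec_of_odd hodd] at h
  by_contra! hE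
  -- Otherwise `a_k w` would have energy `E - 2 ε_k`, below the vacuum energy `-∑ ε_l`.
  have h0 : ∀ k : ZMod N, quasiMode φ k *ᵥ w = 0 := by
    intro k
    by_contra hk
    have h1 := (isCAR_quasiMode φ).sum_number_mul (fun l => (modeEnergy N φ l : ℂ)) k
    rw [← fermionHamiltonian_eq hN hφ] at h1
    have h2 : fermionHamiltonian N φ *ᵥ (quasiMode φ k *ᵥ w) =
        ((E - 2 * modeEnergy N φ k : ℝ) : ℂ) • (quasiMode φ k *ᵥ w) := by
      rw [Matrix.mulVec_mulVec, h1, Matrix.sub_mulVec, ← Matrix.mulVec_mulVec, h,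
        Matrix.mulVec_smul, Matrix.smul_mulVec, ← sub_smul]
      push_cast
      rfl
    have := neg_sum_modeEnergy_le hN hφ hk h2
    linarith [hE k]
  obtain ⟨z, hz⟩ := eq_smul_vacuumMinus hN h0
  have h3 : parityZ N *ᵥ w = w := by
    rw [hz, Matrix.mulVec_smul, parityZ_mulVec_vacuumMinus]
  rw [h3, self_eq_neg] at hodd
  exact hw hodd

lemma exists_modeEnergy_le_of_eigenvector (hN : Odd N) {φ : ℝ}
    (hφ : φ ∈ Set.Ioo 0 (Real.pi / 4)) {E : ℝ} {w : State N} (hw : w ≠ 0)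
    (h : hamiltonian N φ *ᵥ w = (E : ℂ) • w) :
    ∃ k : ZMod N, 2 * modeEnergy N φ k - ∑ l, modeEnergy N φ l ≤ E := by
  -- If the odd part of `w` is nonzero it is an odd eigenvector; otherwise `w` is even and `Π^x w`
  -- is one.
  by_cases hw' : w - parityZ N *ᵥ w = 0
  · have hpar : parityZ N *ᵥ w = w := (sub_eq_zero.mp hw').symm
    have h0 : parity N .x *ᵥ w ≠ 0 := by
      intro h0
      have := congrArg (parity N .x *ᵥ ·) h0
      simp only [Matrix.mulVec_mulVec, parity_mul_self, Matrix.one_mulVec,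
        Matrix.mulVec_zero] at this
      exact hw this
    refine exists_modeEnergy_le hN hφ h0 ?_ ?_
    · rw [Matrix.mulVec_mulVec, parityZ_mul_parity hN, Matrix.neg_mulVec,
        ← Matrix.mulVec_mulVec, hpar]
    · rw [Matrix.mulVec_mulVec, ← hamiltonian_comm_parity_x, ← Matrix.mulVec_mulVec, h,
        Matrix.mulVec_smul]
  · refine exists_modeEnergy_le hN hφ hw' ?_ ?_
    · rw [Matrix.mulVec_sub, Matrix.mulVec_mulVec, parityZ_mul_self, Matrix.one_mulVec, neg_sub]
    · rw [Matrix.mulVec_sub, Matrix.mulVec_mulVec, ← hamiltonian_comm_parityZ,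
        ← Matrix.mulVec_mulVec, h, Matrix.mulVec_smul, smul_sub]

omit [NeZero N] in
lemma groundMomentum_eq (hN : Odd N) :
    groundMomentum N = 2 * Real.pi * (((N + 1) / 4 : ℕ) : ℤ) / N := by
  have hN0 : (N : ℝ) ≠ 0 := Nat.cast_ne_zero.2 hN.pos.ne'
  obtain ⟨n, hn⟩ := hN
  unfold groundMomentum
  split_ifs with h
  · have h1 : N = 4 * ((N + 1) / 4) + 1 := by omega
    generalize (N + 1) / 4 = r at h1 ⊢
    have h2 : (N : ℝ) = 4 * (r : ℝ) + 1 := by exact_mod_cast h1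
    field_simp
    push_cast
    linarith
  · have h1 : N + 1 = 4 * ((N + 1) / 4) := by omega
    generalize (N + 1) / 4 = r at h1 ⊢
    have h2 : (N : ℝ) + 1 = 4 * (r : ℝ) := by exact_mod_cast h1
    field_simp
    push_cast
    linarith

omit [NeZero N] in
lemma cos_two_mul_groundMomentum :
    Real.cos (2 * groundMomentum N) = -Real.cos (Real.pi / N) := by
  unfold groundMomentum
  split_ifs
  · rw [← Real.cos_pi_sub]; congr 1; ring
  · rw [← Real.cos_add_pi]; congr 1; ring

omit [NeZero N] in
lemma cos_odd_mul_pi_div_le (hN : 0 < N) {n : ℤ} (hn : Odd n) :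
    Real.cos (Real.pi * n / N) ≤ Real.cos (Real.pi / N) := by
  have hN0 : (0 : ℝ) < N := Nat.cast_pos.2 hN
  have key : ∀ r : ℤ, 1 ≤ r → r ≤ N → Real.cos (Real.pi * r / N) ≤ Real.cos (Real.pi / N) := by
    intro r h1 h2
    have h1' : (1 : ℝ) ≤ r := by exact_mod_cast h1
    have h2' : (r : ℝ) ≤ N := by exact_mod_cast h2
    refine Real.cos_le_cos_of_nonneg_of_le_pi (by positivity) ?_ ?_
    · rw [div_le_iff₀ hN0]
      exact mul_le_mul_of_nonneg_left h2' Real.pi_pos.le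
    · exact div_le_div_of_nonneg_right (le_mul_of_one_le_right Real.pi_pos.le h1') hN0.le
  have hdiv := Int.mul_ediv_add_emod n (2 * N)
  have hr0 := Int.emod_nonneg n (b := 2 * N) (by omega)
  have hr1 := Int.emod_lt_of_pos n (b := 2 * N) (by omega)
  set r := n % (2 * N)
  set t := n / (2 * N)
  have hr : Odd r := by
    rw [← hdiv] at hn
    have : Even (2 * (N : ℤ) * t) := ⟨N * t, by ring⟩
    rcases Int.even_or_odd r with h | h
    · exact absurd (this.add h) (Int.not_even_iff_odd.mpr hn)
    · exact h
  have hcos : Real.cos (Real.pi * n / N) = Real.cos (Real.pi * r / N) := by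
    have : Real.pi * n / N = Real.pi * r / N + t * (2 * Real.pi) := by
      rw [← hdiv]; push_cast; field_simp; ring
    rw [this, Real.cos_add_int_mul_two_pi]
  obtain ⟨s, hs⟩ := hr
  rw [hcos]
  -- After reduction modulo `2N`, an `r` beyond `N` is reflected to `2N - r`, which brings the angle
  -- into `[π/N, π]`, where cosine decreases.
  by_cases h : r ≤ N
  · exact key r (by omega) h
  · have h1 : Real.cos (Real.pi * r / N) = Real.cos (Real.pi * (2 * N - r : ℤ) / N) := by
      have : Real.pi * (2 * N - r : ℤ) / N = 2 * Real.pi - Real.pi * r / N := by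
        push_cast; field_simp
      rw [this, Real.cos_two_pi_sub]
    rw [h1]
    exact key _ (by omega) (by omega)

lemma modeEnergy_groundMomentum_le (hN : Odd N) {φ : ℝ} (hφ : φ ∈ Set.Ioo 0 (Real.pi / 4))
    (k : ZMod N) : modeEnergy N φ (((N + 1) / 4 : ℕ) : ℤ) ≤ modeEnergy N φ k := by
  obtain ⟨m, rfl⟩ := ZMod.intCast_surjective k
  rw [← norm_dispersion_momentum, ← norm_dispersion_momentum, ← groundMomentum_eq hN]
  refine (sq_le_sq₀ (norm_nonneg _) (norm_nonneg _)).mp ?_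
  rw [dispersion_sq', dispersion_sq', cos_two_mul_groundMomentum]
  have hs : 0 ≤ Real.sin (2 * φ) :=
    Real.sin_nonneg_of_nonneg_of_le_pi (by linarith [hφ.1]) (by linarith [hφ.2, Real.pi_pos])
  have hN0 : (N : ℝ) ≠ 0 := Nat.cast_ne_zero.2 (NeZero.ne N)
  -- For `q = 2πm/N`, `2q - π` is `π/N` times the odd integer `4m - N`, so `cos 2q` cannot fall
  -- below `-cos (π/N)`, its value at `p`.
  have hodd : Odd (4 * m - N : ℤ) :=
    Even.sub_odd ⟨2 * m, by ring⟩ ((Int.odd_coe_nat N).mpr hN)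
  have h := cos_odd_mul_pi_div_le hN.pos hodd
  have h1 : 2 * (2 * Real.pi * m / N) = Real.pi * (4 * m - N : ℤ) / N + Real.pi := by
    push_cast; field_simp; ring
  rw [h1, Real.cos_add_pi]
  have := mul_le_mul_of_nonneg_left (neg_le_neg h) hs
  linarith

end GroundState

/-! ### Action of translation and reflection on the one-particle states. -/

section Symmetry

lemma fourierCoeff_finRotate (k : ZMod N) (j : Fin N) :
    fourierCoeff k j = ZMod.stdAddChar k * fourierCoeff k (finRotate N j) := by
  rw [fourierCoeff, fourierCoeff, siteClass_finRotate, mul_left_comm, ← AddChar.map_add_eq_mul]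
  congr 2; ring

lemma fourierCoeff_rev (k : ZMod N) (j : Fin N) :
    fourierCoeff k j = ZMod.stdAddChar (-k) * fourierCoeff (-k) j.rev := by
  rw [fourierCoeff, fourierCoeff, siteClass_rev, mul_left_comm, ← AddChar.map_add_eq_mul]
  congr 2; ring

lemma star_mode (k : ZMod N) : star (mode k) = ∑ j, fourierCoeff (-k) j • (jordanWigner j)ᴴ := by
  simp only [mode, star_sum, star_smul, star_fourierCoeff, Matrix.star_eq_conjTranspose]

lemma fermionShift_mul_mode (k : ZMod N) :
    fermionShift N * mode k = (ZMod.stdAddChar k : ℂ) • (mode k * fermionShift N) := by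
  have h : mode k = ∑ j, fourierCoeff k (finRotate N j) • jordanWigner (finRotate N j) :=
    (Equiv.sum_comp (finRotate N) fun j => fourierCoeff k j • jordanWigner j).symm
  conv_rhs => rw [h]
  rw [mode, Finset.mul_sum, Finset.sum_mul, Finset.smul_sum]
  refine Finset.sum_congr rfl fun j _ => ?_
  rw [mul_smul_comm, fermionShift_mul_jordanWigner, fourierCoeff_finRotate, mul_smul,
    smul_mul_assoc]

lemma fermionShift_mul_star_mode (k : ZMod N) : fermionShift N * star (mode k) =
    (ZMod.stdAddChar (-k) : ℂ) • (star (mode k) * fermionShift N) := by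
  have h : star (mode k) =
      ∑ j, fourierCoeff (-k) (finRotate N j) • (jordanWigner (finRotate N j))ᴴ := by
    rw [star_mode]
    exact (Equiv.sum_comp (finRotate N) fun j => fourierCoeff (-k) j • (jordanWigner j)ᴴ).symm
  conv_rhs => rw [h]
  rw [star_mode, Finset.mul_sum, Finset.sum_mul, Finset.smul_sum]
  refine Finset.sum_congr rfl fun j _ => ?_
  rw [mul_smul_comm, fermionShift_mul_jordanWigner_conjTranspose, fourierCoeff_finRotate,
    mul_smul, smul_mul_assoc]

lemma stdAddChar_mul_neg (k : ZMod N) :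
    (ZMod.stdAddChar k : ℂ) * ZMod.stdAddChar (-k) = 1 := by
  rw [← AddChar.map_add_eq_mul, add_neg_cancel, AddChar.map_zero_eq_one]

lemma star_stdAddChar (k : ZMod N) :
    star (ZMod.stdAddChar k : ℂ) = ZMod.stdAddChar (-k) := by
  rw [Complex.star_def, AddChar.map_neg_eq_conj]

lemma fermionShift_mulVec_vacuumMinus (φ : ℝ) :
    fermionShift N *ᵥ vacuumMinus N φ = vacuumMinus N φ := by
  refine mulVec_vacuumMinus_of_commute fermionShift_mulVec_allUp (fun k => ?_) φ
  rw [commute_iff_eq, ← mul_assoc, fermionShift_mul_star_mode, smul_mul_assoc, mul_assoc,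
    fermionShift_mul_star_mode, mul_smul_comm, smul_smul, neg_neg, mul_comm,
    stdAddChar_mul_neg, one_smul, mul_assoc]

lemma translation_mulVec_particle (φ : ℝ) (k : ZMod N) :
    permOp (finRotate N) *ᵥ particle φ k = (ZMod.stdAddChar (-k) : ℂ) • particle φ k := by
  rw [← fermionShift_mulVec_of_odd (parityZ_mulVec_particle φ k)]
  have h : fermionShift N * star (quasiMode φ k) =
      (ZMod.stdAddChar (-k) : ℂ) • (star (quasiMode φ k) * fermionShift N) := by
    rw [quasiMode, star_bogoliubovTransform, mul_sub, mul_smul_comm, mul_smul_comm,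
      fermionShift_mul_mode, fermionShift_mul_star_mode, sub_mul, smul_mul_assoc, smul_mul_assoc]
    module
  rw [particle, Matrix.mulVec_mulVec, h, Matrix.smul_mulVec, ← Matrix.mulVec_mulVec,
    fermionShift_mulVec_vacuumMinus]

lemma reflection_mul_mode (k : ZMod N) : permOp Fin.revPerm * mode k =
    (ZMod.stdAddChar (-k) : ℂ) • (parityZ N * mode (-k) * permOp Fin.revPerm) := by
  have h : mode (-k) = ∑ j : Fin N, fourierCoeff (-k) j.rev • jordanWigner j.rev :=
    (Equiv.sum_comp Fin.revPerm fun j => fourierCoeff (-k) j • jordanWigner j).symm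
  rw [h, mode]
  simp only [Finset.mul_sum, Finset.sum_mul, Finset.smul_sum]
  refine Finset.sum_congr rfl fun j _ => ?_
  rw [mul_smul_comm, reflection_mul_jordanWigner, fourierCoeff_rev, mul_smul, mul_smul_comm,
    smul_mul_assoc]

lemma reflection_mul_star_mode (k : ZMod N) : permOp Fin.revPerm * star (mode k) =
    (ZMod.stdAddChar k : ℂ) • (star (mode (-k)) * parityZ N * permOp Fin.revPerm) := by
  have h : star (mode (-k)) = ∑ j : Fin N, fourierCoeff k j.rev • (jordanWigner j.rev)ᴴ := by
    rw [star_mode, neg_neg]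
    exact (Equiv.sum_comp Fin.revPerm fun j => fourierCoeff k j • (jordanWigner j)ᴴ).symm
  rw [h, star_mode]
  simp only [Finset.mul_sum, Finset.sum_mul, Finset.smul_sum]
  refine Finset.sum_congr rfl fun j _ => ?_
  rw [mul_smul_comm, reflection_mul_jordanWigner_conjTranspose, fourierCoeff_rev, neg_neg,
    mul_smul, smul_mul_assoc, smul_mul_assoc]

lemma reflection_mulVec_vacuumMinus (φ : ℝ) :
    permOp Fin.revPerm *ᵥ vacuumMinus N φ = vacuumMinus N φ := by
  refine mulVec_vacuumMinus_of_commute (permOp_mulVec_allUp _) (fun k => ?_) φ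
  calc permOp Fin.revPerm * (star (mode k) * star (mode (-k)))
      = (ZMod.stdAddChar k : ℂ) •
          (star (mode (-k)) * parityZ N * (permOp Fin.revPerm * star (mode (-k)))) := by
        rw [← mul_assoc, reflection_mul_star_mode, smul_mul_assoc, mul_assoc]
    _ = star (mode (-k)) * (parityZ N * star (mode k)) * parityZ N * permOp Fin.revPerm := by
        rw [reflection_mul_star_mode, mul_smul_comm, smul_smul, stdAddChar_mul_neg, one_smul,
          neg_neg]
        simp only [mul_assoc]
    _ = -(star (mode (-k)) * star (mode k)) * (parityZ N * parityZ N) * permOp Fin.revPerm := by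
        rw [parityZ_mul_star_mode]
        noncomm_ring
    _ = star (mode k) * star (mode (-k)) * permOp Fin.revPerm := by
        rw [parityZ_mul_self, mul_one,
          eq_neg_of_add_eq_zero_left (isCAR_mode.star_anticomm (-k) k), neg_neg]

lemma reflection_mulVec_particle (φ : ℝ) (k : ZMod N) :
    permOp Fin.revPerm *ᵥ particle φ k = (ZMod.stdAddChar k : ℂ) • particle φ (-k) := by
  have h : permOp Fin.revPerm * star (quasiMode φ k) = (ZMod.stdAddChar k : ℂ) •
      (star (quasiMode φ (-k)) * (parityZ N * permOp Fin.revPerm)) := by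
    rw [quasiMode, quasiMode, star_bogoliubovTransform, star_bogoliubovTransform, mul_sub,
      mul_smul_comm, mul_smul_comm, reflection_mul_mode, reflection_mul_star_mode, neg_neg,
      parityZ_mul_mode, modeAngle_neg, Real.cos_neg, Real.sin_neg, sub_mul, smul_mul_assoc,
      smul_mul_assoc, ofReal_neg]
    simp only [mul_assoc, neg_mul]
    module
  rw [particle, Matrix.mulVec_mulVec, h, Matrix.smul_mulVec, ← Matrix.mulVec_mulVec,
    ← Matrix.mulVec_mulVec, reflection_mulVec_vacuumMinus, parityZ_mulVec_vacuumMinus, particle]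

end Symmetry

end

section

open Complex

/-! ### Site dependence and reality of the matrix elements. -/

section Magnetization

variable {N : ℕ} [NeZero N]

/-- The matrix element `⟨k|σ_j^γ Π^γ|-k⟩`. -/
def flipElement (φ : ℝ) (k : ZMod N) (γ : Direction) (j : Fin N) : ℂ :=
  matrixElement (particle φ k) (spin γ j * parity N γ) (particle φ (-k))

omit [NeZero N] in
lemma permOp_mul_spin_mul_parity (π : Equiv.Perm (Fin N)) (γ : Direction) (j : Fin N) :
    permOp π * (spin γ j * parity N γ) = spin γ (π j) * parity N γ * permOp π := by
  rw [← mul_assoc, permOp_mul_spin, mul_assoc, permOp_mul_parity, mul_assoc]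

lemma flipElement_finRotate (φ : ℝ) (k : ZMod N) (γ : Direction) (j : Fin N) :
    flipElement φ k γ (finRotate N j) = ZMod.stdAddChar (-2 * k) * flipElement φ k γ j := by
  set T : Op N := permOp (finRotate N) with hT
  have h1 : particle φ (-k) = (ZMod.stdAddChar (-k) : ℂ) • (T *ᵥ particle φ (-k)) := by
    rw [translation_mulVec_particle, smul_smul, neg_neg, mul_comm, stdAddChar_mul_neg, one_smul]
  have h2 : Tᴴ *ᵥ particle φ k = (ZMod.stdAddChar k : ℂ) • particle φ k := by
    have h := congrArg (Tᴴ *ᵥ ·) (translation_mulVec_particle φ k)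
    simp only [Matrix.mulVec_mulVec, hT, permOp_conjTranspose_mul, Matrix.one_mulVec,
      Matrix.mulVec_smul] at h
    conv_rhs => rw [h]
    rw [smul_smul, stdAddChar_mul_neg, one_smul]
  rw [flipElement, matrixElement, h1, Matrix.mulVec_smul, braket_smul_right,
    Matrix.mulVec_mulVec, ← permOp_mul_spin_mul_parity, ← Matrix.mulVec_mulVec, braket_mulVec,
    h2, braket_smul_left, star_stdAddChar, flipElement, matrixElement, ← mul_assoc,
    ← AddChar.map_add_eq_mul]
  congr 2; ring_nf

/-- Iterated translation from site `N`, whose class is `0`; the induction starts at its successor,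
site `1`, which has index `0`. -/
lemma flipElement_eq (φ : ℝ) (k : ZMod N) (γ : Direction) {l : Fin N} (hl : (l : ℕ) + 1 = N)
    (j : Fin N) :
    flipElement φ k γ j = ZMod.stdAddChar (-2 * k * siteClass j) * flipElement φ k γ l := by
  obtain ⟨j, hj⟩ := j
  induction j with
  | zero =>
    have h : (⟨0, hj⟩ : Fin N) = finRotate N l := by
      ext; rw [finRotate_val, if_pos hl]
    rw [h, flipElement_finRotate, siteClass_finRotate]
    have : siteClass l = 0 := by simp [siteClass, hl]
    rw [this, zero_add, mul_one]
  | succ j ih =>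
    have h : (⟨j + 1, hj⟩ : Fin N) = finRotate N ⟨j, by omega⟩ := by
      ext; rw [finRotate_val, if_neg (by simp; omega)]
    rw [h, flipElement_finRotate, ih, siteClass_finRotate, ← mul_assoc,
      ← AddChar.map_add_eq_mul]
    congr 2; ring

lemma star_flipElement (φ : ℝ) (k : ZMod N) (γ : Direction) (j : Fin N) :
    star (flipElement φ k γ j) = flipElement φ (-k) γ j := by
  rw [flipElement, matrixElement, star_braket, flipElement, matrixElement, braket_mulVec,
    Matrix.conjTranspose_mul, spin_conjTranspose, parity_conjTranspose, neg_neg,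
    spin_mul_parity_comm]

lemma flipElement_rev (φ : ℝ) (k : ZMod N) (γ : Direction) (j : Fin N) :
    flipElement φ k γ j = ZMod.stdAddChar (-2 * k) * flipElement φ (-k) γ j.rev := by
  set R : Op N := permOp Fin.revPerm with hR
  have h1 : spin γ j * parity N γ = Rᴴ * (spin γ j.rev * parity N γ) * R := by
    have := permOp_mul_spin_mul_parity Fin.revPerm γ j
    rw [Fin.revPerm_apply] at this
    rw [mul_assoc, ← this, ← mul_assoc, permOp_conjTranspose_mul, one_mul]
  rw [flipElement, matrixElement, h1, ← Matrix.mulVec_mulVec, ← Matrix.mulVec_mulVec,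
    braket_mulVec, Matrix.conjTranspose_conjTranspose, hR, reflection_mulVec_particle,
    reflection_mulVec_particle, Matrix.mulVec_smul, braket_smul_right, braket_smul_left,
    star_stdAddChar, ← mul_assoc, ← AddChar.map_add_eq_mul, flipElement, matrixElement]
  congr 2; ring_nf

/-- Reflection takes site `N` to site `1`, and one translation relates the two. The phases cancel,
so the element equals the one with `k` and `-k` exchanged, which is its conjugate. -/
lemma flipElement_im (φ : ℝ) (k : ZMod N) (γ : Direction) {l : Fin N} (hl : (l : ℕ) + 1 = N) :
    (flipElement φ k γ l).im = 0 := by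
  have h0 : l.rev = finRotate N l := by
    ext; rw [finRotate_val, if_pos hl, Fin.val_rev]; omega
  have h1 := flipElement_rev φ k γ l
  rw [h0, flipElement_finRotate, ← mul_assoc, ← AddChar.map_add_eq_mul,
    show -2 * k + -2 * -k = 0 by ring, AddChar.map_zero_eq_one, one_mul,
    ← star_flipElement] at h1
  exact Complex.conj_eq_iff_im.mp h1.symm

end Magnetization

/-! ### The phase of the magnetization. -/

section Phase

/-- The factor that relates `Π^x` to `Π^γ` on the states of odd fermion number. -/
def parityFactor (N : ℕ) : Direction → ℂ
  | .x => 1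
  | .y => -(I ^ N)⁻¹

lemma parity_x_mulVec_of_odd {N : ℕ} {v : State N} (hv : parityZ N *ᵥ v = -v) (γ : Direction) :
    parity N .x *ᵥ v = parityFactor N γ • (parity N γ *ᵥ v) := by
  cases γ
  · simp [parityFactor]
  · rw [parity_y_eq, Matrix.smul_mulVec, ← Matrix.mulVec_mulVec, hv, Matrix.mulVec_neg, smul_smul,
      parityFactor, neg_mul, inv_mul_cancel₀ (pow_ne_zero _ I_ne_zero), neg_smul, smul_neg,
      one_smul, neg_neg]

lemma re_phase {N : ℕ} [NeZero N] (hN : Odd N) (θ : ℝ) (γ : Direction) (j : Fin N) :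
    (exp (I * θ) * (parityFactor N γ * ZMod.stdAddChar
      (-2 * ((((N + 1) / 4 : ℕ) : ℤ) : ZMod N) * siteClass j))).re =
      (-1) ^ ((j : ℕ) + 1) *
        Real.cos (Real.pi * (((j : ℕ) + 1 : ℕ) : ℝ) / N + phase γ θ N) := by
  have hN0 : (N : ℂ) ≠ 0 := Nat.cast_ne_zero.2 (NeZero.ne N)
  have hcos : ∀ (x : ℝ) (n : ℕ), Real.cos (x - n * Real.pi) = (-1) ^ n * Real.cos x :=
    Real.cos_sub_nat_mul_pi
  have hcast : -2 * ((((N + 1) / 4 : ℕ) : ℤ) : ZMod N) * siteClass j =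
      ((-2 * (((N + 1) / 4 : ℕ) : ℤ) * (((j : ℕ) + 1 : ℕ) : ℤ) : ℤ) : ZMod N) := by
    simp [siteClass]
  rw [hcast, ZMod.stdAddChar_coe]
  generalize hn : (j : ℕ) + 1 = n
  have hI : exp ((Real.pi / 2 : ℝ) * I) = I := by push_cast; exact exp_pi_div_two_mul_I
  have hI' : exp ((-(Real.pi / 2) : ℝ) * I) = -I := by
    push_cast; rw [neg_mul, exp_neg, exp_pi_div_two_mul_I, inv_I]
  obtain ⟨r, hr | hr⟩ : ∃ r, N = 4 * r + 1 ∨ N = 4 * r + 3 := by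
    obtain ⟨s, hs⟩ := hN
    exact ⟨N / 4, by omega⟩
  · have hr1 : (N + 1) / 4 = r := by omega
    have hr2 : (N - 1) / 2 = 2 * r := by omega
    have hrN : (r : ℂ) = ((N : ℂ) - 1) / 4 := by rw [hr]; push_cast; ring
    -- `δ` is the argument of `parityFactor`: `0` for `x`, and `π/2` for `y` since `-i⁻¹ = i`. For
    -- `N ≡ 3 (mod 4)` it becomes `-π/2`, and the whole phase changes sign.
    obtain ⟨δ, hfac, hph⟩ : ∃ δ : ℝ,
        parityFactor N γ = exp ((δ : ℂ) * I) ∧ phase γ θ N = θ + δ := by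
      cases γ
      · exact ⟨0, by simp [parityFactor], by simp [phase, hr2, pow_mul]⟩
      · refine ⟨Real.pi / 2, ?_, by simp [phase, hr2, pow_mul]⟩
        rw [hI, parityFactor, hr, pow_succ, pow_mul, I_pow_four, one_pow, one_mul, inv_I, neg_neg]
    rw [hfac, hph, hr1, ← exp_add, ← exp_add, ← hcos]
    rw [← exp_ofReal_mul_I_re]
    congr 2
    push_cast
    rw [hrN]
    field_simp
    ring
  · have hr1 : (N + 1) / 4 = r + 1 := by omega
    have hr2 : (N - 1) / 2 = 2 * r + 1 := by omega
    have hrN : (r : ℂ) = ((N : ℂ) - 3) / 4 := by rw [hr]; push_cast; ring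
    obtain ⟨δ, hfac, hph⟩ : ∃ δ : ℝ,
        parityFactor N γ = exp ((δ : ℂ) * I) ∧ phase γ θ N = -(θ + δ) := by
      cases γ
      · exact ⟨0, by simp [parityFactor], by simp [phase, hr2, pow_succ, pow_mul]⟩
      · refine ⟨-(Real.pi / 2), ?_, by simp [phase, hr2, pow_succ, pow_mul]; ring⟩
        rw [hI', parityFactor, hr, pow_add, pow_mul, I_pow_four, one_pow, one_mul, I_pow_three,
          inv_neg, inv_I, neg_neg]
    rw [hfac, hph, hr1, ← exp_add, ← exp_add, ← hcos]
    -- Here `2p = π + π/N`, so the exponent is minus the argument of the stated cosine, up to a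
    -- multiple of `2π`; evenness of cosine absorbs the sign.
    have hneg : Real.pi * (n : ℝ) / N + -(θ + δ) - n * Real.pi =
      -(θ + δ - Real.pi * n / N - n * Real.pi + 2 * n * Real.pi) := by ring
    rw [hneg, Real.cos_neg, show 2 * (n : ℝ) * Real.pi = n * (2 * Real.pi) by ring,
      Real.cos_add_nat_mul_two_pi, ← exp_ofReal_mul_I_re]
    congr 2
    push_cast
    rw [hrN]
    field_simp
    ring

end Phase

/-! ### Assembly for the superposition state. -/

section Main

variable {N : ℕ} [NeZero N]

/-- The class modulo `N` of the integer `k` for which `groundMomentum N = 2πk/N`. -/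
def groundIndex (N : ℕ) : ZMod N := ((((N + 1) / 4 : ℕ) : ℤ) : ZMod N)

lemma oneParticle_groundMomentum (hN : Odd N) (φ : ℝ) :
    oneParticle N φ (groundMomentum N) = particle φ (groundIndex N) := by
  rw [groundMomentum_eq hN, oneParticle_momentum, groundIndex]

lemma oneParticle_neg_groundMomentum (hN : Odd N) (φ : ℝ) :
    oneParticle N φ (-groundMomentum N) = particle φ (-groundIndex N) := by
  have h : -(2 * Real.pi * (((N + 1) / 4 : ℕ) : ℤ) / N : ℝ) =
      2 * Real.pi * (-(((N + 1) / 4 : ℕ) : ℤ) : ℤ) / N := by push_cast; ring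
  rw [groundMomentum_eq hN, h, oneParticle_momentum, groundIndex, Int.cast_neg]

lemma tildeG_eq (hN : Odd N) (φ θ : ℝ) : tildeG N φ θ = (1 / (Real.sqrt 2 : ℂ)) •
    (particle φ (groundIndex N) +
      exp (I * θ) • (parity N .x *ᵥ particle φ (-groundIndex N))) := by
  rw [tildeG, oneParticle_groundMomentum hN, oneParticle_neg_groundMomentum hN]

omit [NeZero N] in
-- For Hermitian `A` the two cross terms are conjugate. It is used with `A = 1` for the norm and `A
-- = σ_j^γ` for the magnetization.
lemma braket_superposition (u v : State N) (θ : ℝ) (A : Op N) (hA : Aᴴ = A) :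
    matrixElement ((1 / (Real.sqrt 2 : ℂ)) • (u + exp (I * θ) • v)) A
      ((1 / (Real.sqrt 2 : ℂ)) • (u + exp (I * θ) • v)) =
    (braket u (A *ᵥ u) + braket v (A *ᵥ v)) / 2 +
      ((exp (I * θ) * braket u (A *ᵥ v)).re : ℂ) := by
  have h1 : star (1 / (Real.sqrt 2 : ℂ)) * (1 / (Real.sqrt 2 : ℂ)) = 1 / 2 := by
    rw [star_div₀, star_one, Complex.star_def, conj_ofReal, div_mul_div_comm, one_mul,
      ← ofReal_mul, Real.mul_self_sqrt (by norm_num)]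
    norm_num
  have h2 : star (exp (I * θ)) * exp (I * θ) = 1 := by
    rw [Complex.star_def, ← normSq_eq_conj_mul_self, normSq_eq_norm_sq, norm_exp_I_mul_ofReal]
    norm_num
  have h3 : braket v (A *ᵥ u) = star (braket u (A *ᵥ v)) := by
    rw [star_braket, braket_mulVec, hA]
  rw [matrixElement, Matrix.mulVec_smul, braket_smul_left, braket_smul_right, ← mul_assoc, h1,
    Matrix.mulVec_add, Matrix.mulVec_smul, braket_add_left, braket_add_right, braket_add_right,
    braket_smul_left, braket_smul_left, braket_smul_right, braket_smul_right, h3,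
    re_eq_add_conj, map_mul]
  simp only [← Complex.star_def]
  linear_combination (braket v (A *ᵥ v)) / 2 * h2

lemma parityZ_mulVec_parity_x (hN : Odd N) (φ : ℝ) (k : ZMod N) :
    parityZ N *ᵥ (parity N .x *ᵥ particle φ k) = parity N .x *ᵥ particle φ k := by
  rw [Matrix.mulVec_mulVec, parityZ_mul_parity hN, Matrix.neg_mulVec, ← Matrix.mulVec_mulVec,
    parityZ_mulVec_particle, Matrix.mulVec_neg, neg_neg]

omit [NeZero N] in
lemma parityZ_mulVec_spin (γ : Direction) (j : Fin N) (v : State N) :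
    parityZ N *ᵥ (spin γ j *ᵥ v) = -(spin γ j *ᵥ (parityZ N *ᵥ v)) := by
  rw [Matrix.mulVec_mulVec, parityZ_mul_spin, Matrix.neg_mulVec, Matrix.mulVec_mulVec]

lemma braket_tildeG (hN : Odd N) (φ θ : ℝ) : braket (tildeG N φ θ) (tildeG N φ θ) = 1 := by
  have h := braket_superposition (particle φ (groundIndex N))
    (parity N .x *ᵥ particle φ (-groundIndex N)) θ 1 Matrix.conjTranspose_one
  rw [← tildeG_eq hN, matrixElement] at h
  simp only [Matrix.one_mulVec] at h
  rw [h, braket_particle hN, braket_eq_zero_of_parity parityZ_conjTranspose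
    (parityZ_mulVec_particle φ _) (parityZ_mulVec_parity_x hN φ _), braket_mulVec,
    parity_conjTranspose, Matrix.mulVec_mulVec, parity_mul_self, Matrix.one_mulVec,
    braket_particle hN]
  simp

lemma isGroundState_tildeG (hN : Odd N) {φ : ℝ} (hφ : φ ∈ Set.Ioo 0 (Real.pi / 4)) (θ : ℝ) :
    IsGroundState (hamiltonian N φ) (tildeG N φ θ) := by
  refine ⟨fun h => ?_, 2 * modeEnergy N φ (groundIndex N) - ∑ l, modeEnergy N φ l, ?_, ?_⟩
  · have h1 := braket_tildeG hN φ θ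
    rw [h, braket_zero_left] at h1
    exact zero_ne_one h1
  · rw [tildeG_eq hN, Matrix.mulVec_smul, Matrix.mulVec_add, Matrix.mulVec_smul,
      hamiltonian_mulVec_particle hN hφ, Matrix.mulVec_mulVec, ← hamiltonian_comm_parity_x,
      ← Matrix.mulVec_mulVec, hamiltonian_mulVec_particle hN hφ, Matrix.mulVec_smul,
      modeEnergy_neg]
    module
  · intro E w hw h
    obtain ⟨k, hk⟩ := exists_modeEnergy_le_of_eigenvector hN hφ hw h
    have := modeEnergy_groundMomentum_le hN hφ k
    rw [groundIndex]
    linarith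

lemma matrixElement_tildeG (hN : Odd N) (φ θ : ℝ) (γ : Direction) {l : Fin N}
    (hl : (l : ℕ) + 1 = N) (j : Fin N) :
    matrixElement (tildeG N φ θ) (spin γ j) (tildeG N φ θ) =
      (((-1) ^ ((j : ℕ) + 1) *
        Real.cos (Real.pi * (((j : ℕ) + 1 : ℕ) : ℝ) / N + phase γ θ N) : ℝ) : ℂ) *
      flipElement φ (groundIndex N) γ l := by
  have h1 : braket (particle φ (groundIndex N)) (spin γ j *ᵥ particle φ (groundIndex N)) = 0 := by
    refine braket_eq_zero_of_parity parityZ_conjTranspose (parityZ_mulVec_particle φ _) ?_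
    rw [parityZ_mulVec_spin, parityZ_mulVec_particle, Matrix.mulVec_neg, neg_neg]
  have h2 : braket (parity N .x *ᵥ particle φ (-groundIndex N))
      (spin γ j *ᵥ (parity N .x *ᵥ particle φ (-groundIndex N))) = 0 := by
    rw [← star_braket, star_eq_zero]
    refine braket_eq_zero_of_parity parityZ_conjTranspose ?_ (parityZ_mulVec_parity_x hN φ _)
    rw [parityZ_mulVec_spin, parityZ_mulVec_parity_x hN]
  have h3 : braket (particle φ (groundIndex N))
      (spin γ j *ᵥ (parity N .x *ᵥ particle φ (-groundIndex N))) =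
      parityFactor N γ * flipElement φ (groundIndex N) γ j := by
    rw [parity_x_mulVec_of_odd (parityZ_mulVec_particle φ _) γ, Matrix.mulVec_smul,
      braket_smul_right, Matrix.mulVec_mulVec, flipElement, matrixElement]
  -- Reality at site `N` lets this factor be taken out of the real part.
  have h4 : flipElement φ (groundIndex N) γ l =
      ((flipElement φ (groundIndex N) γ l).re : ℂ) :=
    Complex.ext rfl (by rw [flipElement_im φ _ γ hl, ofReal_im])
  rw [tildeG_eq hN, braket_superposition _ _ _ _ (spin_conjTranspose γ j), h1, h2, h3,
    flipElement_eq φ _ γ hl j, h4, ← re_phase hN, ← groundIndex]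
  rw [← mul_assoc, ← mul_assoc, re_mul_ofReal, ← mul_assoc]
  simp

end Main

end

end XYChain

end

theorem mainTheorem3 (N : ℕ) (hN : Odd N) (φ : ℝ) (hφ : φ ∈ Set.Ioo 0 (Real.pi / 4)) (θ : ℝ) :
    -- the state is a normalized ground state of the chain
    XYChain.IsGroundState (XYChain.hamiltonian N φ) (XYChain.tildeG N φ θ) ∧
    XYChain.braket (XYChain.tildeG N φ θ) (XYChain.tildeG N φ θ) = 1 ∧
    -- the matrix elements at site `N` are real
    (∀ γ : XYChain.Direction,
      (XYChain.matrixElement (XYChain.oneParticle N φ (XYChain.groundMomentum N))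
        (XYChain.spin γ ⟨N - 1, Nat.sub_lt hN.pos Nat.one_pos⟩ * XYChain.parity N γ)
        (XYChain.oneParticle N φ (-XYChain.groundMomentum N))).im = 0) ∧
    -- the magnetization at the site with number `j + 1`
    (∀ (γ : XYChain.Direction) (j : Fin N),
      XYChain.matrixElement (XYChain.tildeG N φ θ) (XYChain.spin γ j) (XYChain.tildeG N φ θ) =
        (((-1) ^ ((j : ℕ) + 1) *
          Real.cos (Real.pi * (((j : ℕ) + 1 : ℕ) : ℝ) / N + XYChain.phase γ θ N) : ℝ) : ℂ) *
        XYChain.matrixElement (XYChain.oneParticle N φ (XYChain.groundMomentum N))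
          (XYChain.spin γ ⟨N - 1, Nat.sub_lt hN.pos Nat.one_pos⟩ * XYChain.parity N γ)
          (XYChain.oneParticle N φ (-XYChain.groundMomentum N))) := by
  have : NeZero N := ⟨hN.pos.ne'⟩
  have hl : N - 1 + 1 = N := Nat.sub_add_cancel hN.pos
  rw [XYChain.oneParticle_groundMomentum hN, XYChain.oneParticle_neg_groundMomentum hN]
  exact ⟨XYChain.isGroundState_tildeG hN hφ θ, XYChain.braket_tildeG hN φ θ,
    fun γ => XYChain.flipElement_im φ _ γ hl,
    fun γ j => XYChain.matrixElement_tildeG hN φ θ γ hl j⟩
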